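/- Let $0\le q\le p$ and $\sigma>0$. Let $M\in\mathbb R^{p\times q}$ have linearly independent columns, let $s$ be a random vector in $\mathbb R^q$ with mean zero, finite second moments and nonsingular covariance matrix, and let $w\sim\mathcal N(0,I_p)$ be independent of $s$. Let $x_1,x_2,\dots$ be independent random vectors in $\mathbb R^p$, each distributed as $Ms+\sqrt{\sigma}\,w$ (in particular, $s$ Gaussian gives the Gaussian model $x_i\sim\mathcal N(0,\Sigma)$). Let $\Sigma$ be the covariance matrix of $x_1$ (so that $\Sigma=BB^T+\sigma I_p$ with $B\in\mathbb R^{p\times q}$ of rank $q$), and let $S_n=\frac1n\sum_{i=1}^n x_ix_i^T$. Let $Q_U=U_{p-q}U_{p-q}^T$, where $\Sigma=U\Lambda U^T$ is an eigendecomposition with $U$ orthogonal and the eigenvalues in decreasing order and $U_{p-q}$ consists of the last $p-q$ columns of $U$; thus $Q_U$ is the orthogonal projector onto the eigenspace of $\Sigma$ for the noise eigenvalue $\sigma$. For each $n$ let likewise $Q_G=G_{p-q}G_{p-q}^T$, where $S_n=GLG^T$ is any eigendecomposition with $G$ orthogonal and the eigenvalues in decreasing order, chosen so that $Q_G$ is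 a measurable function of the outcome. Let $P$ be the $p^2\times p^2$ transposition permutation matrix, $P\,\mathrm{vec}(A)=\mathrm{vec}(A^T)$ for $A\in\mathbb R^{p\times p}$, and put $$\Omega=(I+P)(\Sigma\otimes\Sigma),\qquad \hat\Omega=(Q_U\otimes Q_U)\,\Omega\,(Q_U\otimes Q_U).$$ Then $\hat\Omega$ is symmetric positive semidefinite, and as $n\to\infty$ $$\sqrt n\,\mathrm{vec}\bigl(Q_G(S_n-\sigma I_p)Q_G\bigr)\longrightarrow\mathcal N(0,\hat\Omega)\quad\text{in distribution.}$$ -/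

import Mathlib

open MeasureTheory ProbabilityTheory Filter Matrix
open scoped Kronecker

noncomputable section

namespace SpikedCov

/-- The covariance matrix of a random vector `X` under `P`. -/
def covMatrix {Ω : Type*} [MeasurableSpace Ω] {d : ℕ}
    (X : Ω → EuclideanSpace ℝ (Fin d)) (P : Measure Ω) : Matrix (Fin d) (Fin d) ℝ :=
  Matrix.of fun j k => covariance (fun ω => X ω j) (fun ω => X ω k) P

/-- The sample covariance matrix `(1/n) ∑_{i<n} x_i x_iᵀ`. -/
def sampleCov {Ω : Type*} {p : ℕ} (x : ℕ → Ω → EuclideanSpace ℝ (Fin p)) (n : ℕ) (ω : Ω) :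
    Matrix (Fin p) (Fin p) ℝ :=
  (n : ℝ)⁻¹ • ∑ i ∈ Finset.range n, Matrix.vecMulVec (x i ω) (x i ω)

/-- `A = G diag(l) Gᵀ` with `G` orthogonal and `l 0 ≥ l 1 ≥ …`. -/
structure IsOrderedEigendecomposition {p : ℕ} (A G : Matrix (Fin p) (Fin p) ℝ)
    (l : Fin p → ℝ) : Prop where
  orthogonal : Gᵀ * G = 1
  antitone : Antitone l
  eq : A = G * Matrix.diagonal l * Gᵀ

/-- The last `p - q` columns of a `p × p` matrix. -/
def lastColumns {p : ℕ} (q : ℕ) (G : Matrix (Fin p) (Fin p) ℝ) :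
    Matrix (Fin p) {j : Fin p // q ≤ (j : ℕ)} ℝ :=
  G.submatrix id Subtype.val

/-- `Q` is the orthogonal projector `G_{p-q} G_{p-q}ᵀ` onto the span of eigenvectors belonging to
the `p - q` smallest eigenvalues of `A`, for some ordered eigendecomposition of `A`. -/
def IsNoiseProjector {p : ℕ} (q : ℕ) (A Q : Matrix (Fin p) (Fin p) ℝ) : Prop :=
  ∃ (G : Matrix (Fin p) (Fin p) ℝ) (l : Fin p → ℝ),
    IsOrderedEigendecomposition A G l ∧ Q = lastColumns q G * (lastColumns q G)ᵀ

/-- The transposition permutation matrix (commutation matrix) of order `p²`. -/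
def transpositionMatrix (p : ℕ) : Matrix (Fin p × Fin p) (Fin p × Fin p) ℝ :=
  Matrix.of fun a b => if a = b.swap then 1 else 0

/-- The defining property of the transposition matrix: it sends `vec A` to `vec Aᵀ`. -/
theorem transpositionMatrix_mulVec_vec {p : ℕ} (A : Matrix (Fin p) (Fin p) ℝ) :
    transpositionMatrix p *ᵥ A.vec = Aᵀ.vec := by
  funext a
  have h : ∀ b : Fin p × Fin p, (a = b.swap) = (b = a.swap) := fun b =>
    propext ⟨fun h => by rw [h, Prod.swap_swap], fun h => by rw [h, Prod.swap_swap]⟩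
  simp [transpositionMatrix, Matrix.mulVec, dotProduct, h]

/-- `(I + P)(A ⊗ A)`, with `P` the transposition matrix. -/
def fullAsymptoticCov {p : ℕ} (A : Matrix (Fin p) (Fin p) ℝ) :
    Matrix (Fin p × Fin p) (Fin p × Fin p) ℝ :=
  (1 + transpositionMatrix p) * (A ⊗ₖ A)

/-- `(Q ⊗ Q) (I + P)(A ⊗ A) (Q ⊗ Q)`. -/
def noiseAsymptoticCov {p : ℕ} (Q A : Matrix (Fin p) (Fin p) ℝ) :
    Matrix (Fin p × Fin p) (Fin p × Fin p) ℝ :=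
  (Q ⊗ₖ Q) * fullAsymptoticCov A * (Q ⊗ₖ Q)

end SpikedCov

end

/-!
Write `Q` for the noise projector of the true covariance matrix `Σ`, `H` for that of the sample
covariance matrix `S`, and `T = S - σ`. If `H` is replaced by the fixed projector `Q`, the claim is
the central limit theorem: `√n vec (Q T Q)` is a normalized sum of independent copies of
`vec (Q (x xᵀ - σ) Q)`. Since `Q M = 0` (`noiseProjector_mul_eq_zero`), `Q x = √σ Q w` is Gaussian,
so these summands have all moments although `s` has only two, and Isserlis' formula
(`integral_inner_mul_four_stdGaussian`) identifies their covariance matrix with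
`(Q ⊗ Q)(I + P)(Σ ⊗ Σ)(Q ⊗ Q)`.

The replacement is harmless because its error is of second order: when `S` is close to `Σ`,
`‖H T H - Q T Q‖ ≤ C ‖Q T‖²` (`exists_norm_compression_sub_le`). It matters that the bound involves
`Q T` and not `S - Σ`: the latter need not be of order `n^(-1/2)` under second moments of `s`,
whereas `Q T` is a mean of centered variables `(Q x)_j x_k - σ Q_jk`, which are square integrable
because `s` enters them linearly and is independent of the noise. Hence
`√n E ‖Q T‖² = O(n^(-1/2))` (`tendstoInMeasure_sqrt_mul_sum_sq_mean`), while `S → Σ` by the law of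
large numbers, and Slutsky's theorem concludes.

The perturbation bound rests on the separation of `σ` from the `q` larger eigenvalues of `Σ`
(`spiked_eigenvalues`), which persists for `S` by Weyl's inequality
(`IsOrderedEigendecomposition.sub_norm_le`), so that `T` is boundedly invertible on the range of
`1 - H`.
-/

namespace SpikedCov

/-! ### Perturbation of the noise eigenspace -/

section LinearAlgebra

open scoped Matrix.Norms.Frobenius

variable {p q : ℕ}

theorem frobenius_norm_sq {m n : Type*} [Fintype m] [Fintype n] (A : Matrix m n ℝ) :
    ‖A‖ ^ 2 = ∑ i, ∑ j, A i j ^ 2 := by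
  rw [frobenius_norm_def, ← Real.sqrt_eq_rpow, Real.sq_sqrt (by positivity)]
  simp

theorem frobenius_norm_sq_eq_trace {m n : Type*} [Fintype m] [Fintype n] (A : Matrix m n ℝ) :
    ‖A‖ ^ 2 = (Aᵀ * A).trace := by
  rw [frobenius_norm_sq, Finset.sum_comm]
  simp [trace, mul_apply, sq]

theorem abs_dotProduct_mulVec_le {m : Type*} [Fintype m] (A : Matrix m m ℝ) (v : m → ℝ) :
    |v ⬝ᵥ A *ᵥ v| ≤ ‖A‖ * (v ⬝ᵥ v) := by
  have hv : 0 ≤ v ⬝ᵥ v := Finset.sum_nonneg fun i _ => mul_self_nonneg _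
  refine abs_le_of_sq_le_sq ?_ (by positivity)
  rw [mul_pow, frobenius_norm_sq]
  have h := Finset.sum_mul_sq_le_sq_mul_sq (Finset.univ : Finset (m × m))
    (fun a => A a.1 a.2) (fun a => v a.1 * v a.2)
  simp only [Fintype.sum_prod_type] at h
  convert h using 2
  · simp only [dotProduct, mulVec, Finset.mul_sum]
    exact Finset.sum_congr rfl fun i _ => Finset.sum_congr rfl fun j _ => by ring
  · simp only [dotProduct, sq, Finset.sum_mul_sum]
    exact Finset.sum_congr rfl fun i _ => Finset.sum_congr rfl fun j _ => by ring

theorem IsNoiseProjector.exists_eq {A Q : Matrix (Fin p) (Fin p) ℝ} (h : IsNoiseProjector q A Q) :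
    ∃ (G : Matrix (Fin p) (Fin p) ℝ) (l : Fin p → ℝ), IsOrderedEigendecomposition A G l ∧
      Q = G * diagonal (fun j : Fin p => if q ≤ (j : ℕ) then (1 : ℝ) else 0) * Gᵀ := by
  obtain ⟨G, l, hG, rfl⟩ := h
  refine ⟨G, l, hG, ?_⟩
  ext i j
  rw [mul_apply, mul_apply]
  simp only [lastColumns, submatrix_apply, id, transpose_apply, mul_diagonal]
  rw [← Finset.sum_subtype (Finset.univ.filter fun k : Fin p => q ≤ (k : ℕ)) (by simp)
    (fun k => G i k * G j k), Finset.sum_filter]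
  exact Finset.sum_congr rfl fun k _ => by split_ifs <;> simp

theorem conj_diagonal_mul {G : Matrix (Fin p) (Fin p) ℝ} (hG : Gᵀ * G = 1) (a b : Fin p → ℝ) :
    (G * diagonal a * Gᵀ) * (G * diagonal b * Gᵀ) = G * diagonal (fun i => a i * b i) * Gᵀ := by
  rw [← diagonal_mul_diagonal]
  calc _ = G * diagonal a * (Gᵀ * G) * diagonal b * Gᵀ := by simp only [Matrix.mul_assoc]
    _ = _ := by rw [hG]; simp only [Matrix.mul_assoc, Matrix.mul_one]

theorem conj_indicator_mul_self {G : Matrix (Fin p) (Fin p) ℝ} (hG : Gᵀ * G = 1)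
    (r : Fin p → Prop) [DecidablePred r] :
    (G * diagonal (fun i => if r i then (1 : ℝ) else 0) * Gᵀ) *
        (G * diagonal (fun i => if r i then (1 : ℝ) else 0) * Gᵀ) =
      G * diagonal (fun i => if r i then (1 : ℝ) else 0) * Gᵀ := by
  rw [conj_diagonal_mul hG]
  congr 3
  ext i
  split_ifs <;> simp

theorem conj_diagonal_transpose (G : Matrix (Fin p) (Fin p) ℝ) (a : Fin p → ℝ) :
    (G * diagonal a * Gᵀ)ᵀ = G * diagonal a * Gᵀ := by
  simp [Matrix.mul_assoc]

theorem conj_diagonal_sub_smul_one {G : Matrix (Fin p) (Fin p) ℝ} (hG : Gᵀ * G = 1)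
    (a : Fin p → ℝ) (c : ℝ) :
    G * diagonal a * Gᵀ - c • 1 = G * diagonal (fun i => a i - c) * Gᵀ := by
  have h1 : G * diagonal (fun _ => c) * Gᵀ = c • 1 := by
    rw [← smul_one_eq_diagonal, Matrix.mul_smul, Matrix.smul_mul, Matrix.mul_one,
      mul_eq_one_comm.mp hG]
  rw [← h1, ← Matrix.sub_mul, ← Matrix.mul_sub, diagonal_sub]

theorem one_sub_conj_diagonal {G : Matrix (Fin p) (Fin p) ℝ} (hG : Gᵀ * G = 1) (a : Fin p → ℝ) :
    1 - G * diagonal a * Gᵀ = G * diagonal (fun i => 1 - a i) * Gᵀ := by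
  have h := conj_diagonal_sub_smul_one hG a 1
  rw [← neg_sub, ← one_smul ℝ (1 : Matrix (Fin p) (Fin p) ℝ), h, ← Matrix.neg_mul,
    ← Matrix.mul_neg, diagonal_neg]
  congr 3
  ext i; simp

theorem conj_diagonal_trace {G : Matrix (Fin p) (Fin p) ℝ} (hG : Gᵀ * G = 1) (a : Fin p → ℝ) :
    (G * diagonal a * Gᵀ).trace = ∑ i, a i := by
  rw [Matrix.mul_assoc, trace_mul_comm, Matrix.mul_assoc, hG, Matrix.mul_one, trace_diagonal]

theorem norm_conj_diagonal_le {G : Matrix (Fin p) (Fin p) ℝ} (hG : Gᵀ * G = 1) {a : Fin p → ℝ}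
    {c : ℝ} (hc : 0 ≤ c) (ha : ∀ i, |a i| ≤ c) : ‖G * diagonal a * Gᵀ‖ ≤ √p * c := by
  refine abs_le_of_sq_le_sq' ?_ (by positivity) |>.2
  rw [frobenius_norm_sq_eq_trace, conj_diagonal_transpose, conj_diagonal_mul hG,
    conj_diagonal_trace hG, mul_pow, Real.sq_sqrt (by positivity)]
  calc ∑ i, a i * a i ≤ ∑ _i : Fin p, c ^ 2 := Finset.sum_le_sum fun i _ => by
        rw [← sq, ← sq_abs]; exact pow_le_pow_left₀ (abs_nonneg _) (ha i) 2
    _ = _ := by simp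

theorem mulVec_dotProduct_self {G : Matrix (Fin p) (Fin p) ℝ} (hG : Gᵀ * G = 1)
    (v : Fin p → ℝ) : (G *ᵥ v) ⬝ᵥ (G *ᵥ v) = v ⬝ᵥ v := by
  rw [dotProduct_mulVec, ← mulVec_transpose, mulVec_mulVec, hG, one_mulVec]

theorem dotProduct_conj_diagonal (G : Matrix (Fin p) (Fin p) ℝ) (a : Fin p → ℝ) (v : Fin p → ℝ) :
    v ⬝ᵥ (G * diagonal a * Gᵀ) *ᵥ v = ∑ i, a i * (Gᵀ *ᵥ v) i ^ 2 := by
  rw [← mulVec_mulVec, ← mulVec_mulVec, dotProduct_mulVec, ← mulVec_transpose]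
  simp only [dotProduct, mulVec_diagonal]
  exact Finset.sum_congr rfl fun i _ => by ring

/-- One half of Weyl's inequality: the `j`-th largest eigenvalue drops by at most `‖S - A‖`
(Frobenius norm) when `A` is replaced by `S`. The span of the first `j + 1` eigenvectors of `A`
meets the orthogonal complement of the first `j` eigenvectors of `S`, and a common vector compares the two
quadratic forms. -/
theorem IsOrderedEigendecomposition.sub_norm_le {A S U G : Matrix (Fin p) (Fin p) ℝ}
    {a b : Fin p → ℝ} (hA : IsOrderedEigendecomposition A U a)
    (hS : IsOrderedEigendecomposition S G b) (j : Fin p) : a j - ‖S - A‖ ≤ b j := by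
  -- a vector `U c`, `c` supported on indices `≤ j`, orthogonal to the columns `< j` of `G`
  let L : ({i : Fin p // i ≤ j} → ℝ) →ₗ[ℝ] ({i : Fin p // i < j} → ℝ) :=
    ((Gᵀ * U).submatrix Subtype.val Subtype.val).mulVecLin
  have hL : LinearMap.ker L ≠ ⊥ := by
    apply LinearMap.ker_ne_bot_of_finrank_lt
    simp only [Module.finrank_fintype_fun_eq_card]
    exact Fintype.card_lt_of_injective_of_notMem (fun i => ⟨i.1, i.2.le⟩)
      (fun x y h => Subtype.ext (by simpa using h)) (b := ⟨j, le_rfl⟩)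
      (by rintro ⟨x, hx⟩; exact x.2.ne (by simpa using hx))
  obtain ⟨c', hc'L, hc'0⟩ := (Submodule.ne_bot_iff _).mp hL
  let c : Fin p → ℝ := fun i => if h : i ≤ j then c' ⟨i, h⟩ else 0
  have hc : ∀ i, ¬ i ≤ j → c i = 0 := fun i hi => by simp [c, hi]
  have hcpos : 0 < c ⬝ᵥ c := by
    refine (Finset.sum_nonneg fun i _ => mul_self_nonneg (c i)).lt_of_ne' fun h => hc'0 ?_
    have := dotProduct_self_eq_zero.mp h
    ext ⟨i, hi⟩
    simpa [c, hi] using congrFun this i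
  have hd : ∀ i, i < j → (Gᵀ *ᵥ (U *ᵥ c)) i = 0 := fun i hi => by
    have h := congrFun (LinearMap.mem_ker.mp hc'L) ⟨i, hi⟩
    rw [mulVec_mulVec]
    refine Eq.trans ?_ h
    simp only [L, mulVecLin_apply]
    generalize Gᵀ * U = W
    simp only [mulVec, dotProduct, submatrix_apply]
    rw [← Finset.sum_subset (Finset.subset_univ (Finset.univ.filter fun k => k ≤ j))
      (fun k _ hk => by rw [hc k (by simpa using hk), mul_zero]),
      Finset.sum_subtype (p := fun k => k ≤ j) _ (by simp)]
    exact Finset.sum_congr rfl fun k _ => by simp [c, k.2]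
  have h1 : a j * (c ⬝ᵥ c) ≤ (U *ᵥ c) ⬝ᵥ A *ᵥ (U *ᵥ c) := by
    rw [hA.eq, dotProduct_conj_diagonal, mulVec_mulVec, hA.orthogonal, one_mulVec, dotProduct,
      Finset.mul_sum]
    refine Finset.sum_le_sum fun i _ => ?_
    by_cases hi : i ≤ j
    · rw [← sq]; exact mul_le_mul_of_nonneg_right (hA.antitone hi) (sq_nonneg _)
    · simp [hc i hi]
  have h2 : (U *ᵥ c) ⬝ᵥ S *ᵥ (U *ᵥ c) ≤ b j * (c ⬝ᵥ c) := by
    rw [← mulVec_dotProduct_self hA.orthogonal c,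
      ← mulVec_dotProduct_self (G := Gᵀ) (by simpa using mul_eq_one_comm.mp hS.orthogonal)
        (U *ᵥ c)]
    nth_rewrite 1 [hS.eq]
    rw [dotProduct_conj_diagonal, dotProduct, Finset.mul_sum]
    refine Finset.sum_le_sum fun i _ => ?_
    by_cases hi : i < j
    · simp [hd i hi]
    · rw [← sq]; exact mul_le_mul_of_nonneg_right (hS.antitone (not_lt.mp hi)) (sq_nonneg _)
  have h3 := (abs_le.mp (abs_dotProduct_mulVec_le (S - A) (U *ᵥ c))).1
  rw [mulVec_dotProduct_self hA.orthogonal, sub_mulVec, dotProduct_sub] at h3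
  have h4 : (a j - ‖S - A‖) * (c ⬝ᵥ c) ≤ b j * (c ⬝ᵥ c) := by rw [sub_mul]; linarith
  exact le_of_mul_le_mul_right h4 hcpos

/-- A nonincreasing nonnegative sequence with exactly `q` nonzero terms is nonzero exactly on its
first `q` indices. -/
theorem ne_zero_iff_lt_of_antitone {d : Fin p → ℝ} (hd : Antitone d) (h0 : ∀ i, 0 ≤ d i)
    (hcard : Fintype.card {i // d i ≠ 0} = q) (i : Fin p) : d i ≠ 0 ↔ (i : ℕ) < q := by
  rw [Fintype.card_subtype] at hcard
  constructor
  · intro hi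
    have hsub : Finset.Iic i ⊆ Finset.univ.filter fun i => d i ≠ 0 := fun j hj => by
      have := hd (Finset.mem_Iic.mp hj)
      have := (h0 i).lt_of_ne' hi
      simp; linarith
    have := Finset.card_le_card hsub
    rw [Fin.card_Iic] at this
    omega
  · intro hi hdi
    have hsub : (Finset.univ.filter fun i => d i ≠ 0) ⊆ Finset.Iio i := fun j hj => by
      rw [Finset.mem_Iio]
      by_contra! hij
      have := hd hij
      have := h0 j
      simp at hj
      exact hj (by linarith)
    have := Finset.card_le_card hsub
    rw [Fin.card_Iio] at this
    omega

/-- Second-order control of the compression of `T` when the projector `Q` is replaced by a projector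
`H` of the same trace that commutes with `T`. Here `Q T` measures how far the range of `Q` is from
the kernel of `T`, and `N` inverts `T` on the range of `1 - H`. Then `Q (1 - H) = (Q T) N` is
`O(‖Q T‖)`; equality of the traces gives `‖(1 - Q) H‖ = ‖Q (1 - H)‖` in Frobenius norm, so
`Q - H` and `T H` are `O(‖Q T‖)` too, and the difference of the compressions consists of products
of two such factors. -/
theorem norm_compression_sub_le {T Q H N : Matrix (Fin p) (Fin p) ℝ} {ν g : ℝ}
    (hQt : Qᵀ = Q) (hQ : Q * Q = Q) (hHt : Hᵀ = H) (hH : H * H = H) (hcomm : T * H = H * T)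
    (hN : T * N = 1 - H) (htr : Q.trace = H.trace) (hNν : ‖N‖ ≤ ν) (hQg : ‖Q‖ ≤ g)
    (hHg : ‖H‖ ≤ g) (hsmall : ν * ‖Q * T‖ ≤ 1 / 2) :
    ‖H * T * H - Q * T * Q‖ ≤ (8 * g ^ 2 + 1) * ν * ‖Q * T‖ ^ 2 := by
  set r := ‖Q * T‖ with hr
  have hr0 : 0 ≤ r := norm_nonneg _
  have hν0 : 0 ≤ ν := (norm_nonneg _).trans hNν
  have hg0 : 0 ≤ g := (norm_nonneg _).trans hQg
  have hF : Q * (1 - H) = Q * T * N := by rw [Matrix.mul_assoc, hN]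
  have hf : ‖Q * (1 - H)‖ ≤ ν * r := by
    rw [hF, mul_comm]
    exact (norm_mul_le _ _).trans (by gcongr)
  -- both squared norms equal the common trace minus `tr (H Q)`
  have hf' : ‖(1 - Q) * H‖ = ‖Q * (1 - H)‖ := by
    rw [← sq_eq_sq₀ (norm_nonneg _) (norm_nonneg _), ← frobenius_norm_transpose (Q * (1 - H)),
      frobenius_norm_sq_eq_trace, frobenius_norm_sq_eq_trace]
    simp only [transpose_mul, transpose_sub, transpose_one, hQt, hHt]
    have h1 : H * (1 - Q) * ((1 - Q) * H) = H * H - H * Q * H - H * Q * H + H * (Q * Q) * H := by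
      noncomm_ring
    have h2 : Q * (1 - H) * ((1 - H) * Q) = Q * Q - Q * H * Q - Q * H * Q + Q * (H * H) * Q := by
      noncomm_ring
    have h3 : (H * Q * H).trace = (H * Q).trace := by rw [trace_mul_comm, ← Matrix.mul_assoc, hH]
    have h4 : (Q * H * Q).trace = (H * Q).trace := by
      rw [Matrix.mul_assoc, trace_mul_comm, Matrix.mul_assoc, hQ]
    rw [h1, h2, hH, hQ]
    simp [trace_sub, h3, h4, htr]
  have hD : Q - H = Q * (1 - H) - (1 - Q) * H := by noncomm_ring
  have hDn : ‖Q - H‖ ≤ 2 * (ν * r) := by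
    rw [hD]
    refine (norm_sub_le _ _).trans ?_
    rw [hf']; linarith
  have hX : T * H = Q * T * H + (1 - Q) * H * (T * H) := by
    have : H * (T * H) = T * H := by rw [hcomm, ← Matrix.mul_assoc, hH]
    rw [Matrix.mul_assoc (1 - Q), this]; noncomm_ring
  -- `(1 - Q) H` has norm at most `1 / 2`, so its term can be absorbed
  have hXn : ‖T * H‖ ≤ 2 * (r * g) := by
    have h1 : ‖T * H‖ ≤ r * g + 1 / 2 * ‖T * H‖ := by
      nth_rewrite 1 [hX]
      refine (norm_add_le _ _).trans (add_le_add ?_ ?_)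
      · exact (norm_mul_le _ _).trans (by gcongr)
      · refine (norm_mul_le _ _).trans ?_
        gcongr
        rw [hf']; linarith
    linarith
  have hHTH : H * T * H = H * (T * H) * H := by
    rw [Matrix.mul_assoc H (T * H), Matrix.mul_assoc T, hH, Matrix.mul_assoc]
  have hdecomp : H * T * H - Q * T * Q =
      -((Q - H) * (T * H) * Q + H * (T * H) * (Q - H) + Q * T * (Q * (1 - H))ᵀ) := by
    rw [transpose_mul, transpose_sub, transpose_one, hQt, hHt, hHTH]
    noncomm_ring
  rw [hdecomp, norm_neg]
  calc _ ≤ ‖(Q - H) * (T * H) * Q‖ + ‖H * (T * H) * (Q - H)‖ + ‖Q * T * (Q * (1 - H))ᵀ‖ :=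
        norm_add₃_le
    _ ≤ 2 * (ν * r) * (2 * (r * g)) * g + g * (2 * (r * g)) * (2 * (ν * r)) + r * (ν * r) := by
        gcongr
        · exact (norm_mul_le _ _).trans (mul_le_mul ((norm_mul_le _ _).trans (by gcongr)) hQg
            (norm_nonneg _) (by positivity))
        · exact (norm_mul_le _ _).trans (mul_le_mul ((norm_mul_le _ _).trans (by gcongr)) hDn
            (norm_nonneg _) (by positivity))
        · refine (norm_mul_le _ _).trans ?_
          rw [frobenius_norm_transpose]; gcongr
    _ = _ := by ring

/-- For every `S` near `A`, compressing `S - σ` by the noise projector of `S` instead of that of `A`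
costs only an error quadratic in `Q (S - σ)`. The eigenvalue `σ` of `A` has to be separated from the
`q` larger ones. -/
theorem exists_norm_compression_sub_le {σ : ℝ} {A U Q : Matrix (Fin p) (Fin p) ℝ} {a : Fin p → ℝ}
    (hA : IsOrderedEigendecomposition A U a)
    (hQ : Q = U * diagonal (fun j : Fin p => if q ≤ (j : ℕ) then (1 : ℝ) else 0) * Uᵀ)
    (hgap : ∀ i : Fin p, (i : ℕ) < q → σ < a i) (hnoise : ∀ i : Fin p, q ≤ (i : ℕ) → a i = σ) :
    ∃ ε > 0, ∃ C : ℝ, 0 ≤ C ∧ ∀ S H : Matrix (Fin p) (Fin p) ℝ, IsNoiseProjector q S H →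
      ‖S - A‖ ≤ ε →
        ‖H * (S - σ • 1) * H - Q * (S - σ • 1) * Q‖ ≤ C * ‖Q * (S - σ • 1)‖ ^ 2 := by
  obtain ⟨δ, hδgap, hδ⟩ : ∃ δ : ℝ, (∀ i : Fin p, (i : ℕ) < q → σ + 2 * δ ≤ a i) ∧ 0 < δ := by
    have h1 : ∀ᶠ δ in nhdsWithin (0 : ℝ) (Set.Ioi 0), ∀ i : Fin p, (i : ℕ) < q →
        σ + 2 * δ ≤ a i := by
      refine eventually_all.2 fun i => ?_
      by_cases hi : (i : ℕ) < q
      · have hc : ContinuousWithinAt (fun δ : ℝ => σ + 2 * δ) (Set.Ioi 0) 0 :=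
          Continuous.continuousWithinAt (by fun_prop)
        have := hc.eventually (Iio_mem_nhds (by simpa using hgap i hi))
        filter_upwards [this] with δ h _ using h.le
      · exact .of_forall fun δ h => absurd h hi
    exact (h1.and self_mem_nhdsWithin).exists
  have hQA : Q * (A - σ • 1) = 0 := by
    rw [hQ, hA.eq, conj_diagonal_sub_smul_one hA.orthogonal, conj_diagonal_mul hA.orthogonal]
    have : (fun i : Fin p => (if q ≤ (i : ℕ) then (1 : ℝ) else 0) * (a i - σ)) = 0 := by
      ext i
      by_cases hi : q ≤ (i : ℕ) <;> simp [hi, hnoise]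
    rw [this]; simp
  have hQn : ‖Q‖ ≤ √p := by
    rw [hQ]
    refine (norm_conj_diagonal_le hA.orthogonal zero_le_one fun i => ?_).trans_eq (mul_one _)
    split_ifs <;> simp
  -- `√p / δ` bounds the norm of the inverse of `S - σ` on its top eigenspace, and this radius makes
  -- `(√p / δ) ‖Q (S - σ)‖ ≤ 1 / 2`
  refine ⟨δ / (2 * (p + 1)), by positivity, (8 * √p ^ 2 + 1) * (√p * δ⁻¹), by positivity,
    fun S H hSH hSA => ?_⟩
  obtain ⟨G, b, hS, rfl⟩ := hSH.exists_eq
  have hεδ : δ / (2 * (p + 1)) ≤ δ := div_le_self hδ.le (by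
    have : (0 : ℝ) ≤ p := Nat.cast_nonneg p
    linarith)
  have hb : ∀ i : Fin p, (i : ℕ) < q → δ ≤ b i - σ := fun i hi => by
    have := hA.sub_norm_le hS i
    have := hδgap i hi
    linarith
  have hHn : ‖G * diagonal (fun j : Fin p => if q ≤ (j : ℕ) then (1 : ℝ) else 0) * Gᵀ‖ ≤ √p := by
    refine (norm_conj_diagonal_le hS.orthogonal zero_le_one fun i => ?_).trans_eq (mul_one _)
    split_ifs <;> simp
  have hNn : ‖G * diagonal (fun j : Fin p => if q ≤ (j : ℕ) then 0 else (b j - σ)⁻¹) * Gᵀ‖ ≤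
      √p * δ⁻¹ := by
    refine norm_conj_diagonal_le hS.orthogonal (by positivity) fun i => ?_
    split_ifs with hi
    · simpa using hδ.le
    · have := hb i (not_le.mp hi)
      rw [abs_of_nonneg (inv_nonneg.mpr (hδ.le.trans this))]
      exact inv_anti₀ hδ this
  have hR : ‖Q * (S - σ • 1)‖ ≤ √p * (δ / (2 * (p + 1))) := by
    have : Q * (S - σ • 1) = Q * (S - A) := by
      rw [← sub_eq_zero, ← Matrix.mul_sub, ← hQA]; congr 1; abel
    rw [this]
    exact (norm_mul_le _ _).trans (by gcongr)
  refine norm_compression_sub_le ?_ ?_ (conj_diagonal_transpose _ _) ?_ ?_ ?_ ?_ hNn hQn hHn ?_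
  · rw [hQ, conj_diagonal_transpose]
  · rw [hQ, conj_indicator_mul_self hA.orthogonal]
  · rw [conj_indicator_mul_self hS.orthogonal]
  · rw [hS.eq, conj_diagonal_sub_smul_one hS.orthogonal, conj_diagonal_mul hS.orthogonal,
      conj_diagonal_mul hS.orthogonal]
    simp only [mul_comm]
  · rw [hS.eq, conj_diagonal_sub_smul_one hS.orthogonal, conj_diagonal_mul hS.orthogonal,
      one_sub_conj_diagonal hS.orthogonal]
    congr 3
    ext i
    split_ifs with hi
    · simp
    · have := hb i (not_le.mp hi)
      rw [mul_inv_cancel₀ (by linarith)]; simp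
  · rw [hQ, conj_diagonal_trace hA.orthogonal, conj_diagonal_trace hS.orthogonal]
  · calc √p * δ⁻¹ * ‖Q * (S - σ • 1)‖ ≤ √p * δ⁻¹ * (√p * (δ / (2 * (p + 1)))) := by gcongr
      _ = (√p * √p) / (2 * (p + 1)) := by field_simp
      _ ≤ 1 / 2 := by
        rw [Real.mul_self_sqrt (Nat.cast_nonneg p), div_le_div_iff₀ (by positivity) (by norm_num)]
        linarith

/-- The eigenvalues of `M C Mᵀ + σ`: the first `q` exceed `σ`, the others equal `σ`. -/
theorem spiked_eigenvalues {σ : ℝ} {M : Matrix (Fin p) (Fin q) ℝ}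
    (hM : LinearIndependent ℝ M.col) {C : Matrix (Fin q) (Fin q) ℝ} (hC : C.PosDef)
    {U : Matrix (Fin p) (Fin p) ℝ} {a : Fin p → ℝ}
    (hA : IsOrderedEigendecomposition (M * C * Mᵀ + σ • 1) U a) :
    (∀ i : Fin p, (i : ℕ) < q → σ < a i) ∧ (∀ i : Fin p, q ≤ (i : ℕ) → a i = σ) := by
  have hK : M * C * Mᵀ = U * diagonal (fun i => a i - σ) * Uᵀ := by
    rw [← conj_diagonal_sub_smul_one hA.orthogonal, ← hA.eq, add_sub_cancel_right]
  have hdiag : diagonal (fun i => a i - σ) = Uᵀ * (M * C * Mᵀ) * U := by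
    rw [hK]
    calc _ = (Uᵀ * U) * diagonal (fun i => a i - σ) * (Uᵀ * U) := by simp [hA.orthogonal]
      _ = _ := by simp only [Matrix.mul_assoc]
  have hpsd : ∀ i, 0 ≤ a i - σ := by
    have h1 := (hC.posSemidef.mul_mul_conjTranspose_same M).conjTranspose_mul_mul_same U
    simp only [conjTranspose_eq_transpose_of_trivial] at h1
    rw [← hdiag] at h1
    exact fun i => posSemidef_diagonal_iff.mp h1 i
  have hMM : IsUnit (Mᵀ * M) := by
    have := PosDef.conjTranspose_mul_self M (mulVec_injective_iff.mpr hM)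
    exact this.isUnit
  have hrank : (M * C * Mᵀ).rank = q := by
    refine le_antisymm ?_ ?_
    · rw [Matrix.mul_assoc]
      exact (rank_mul_le_left _ _).trans (by simpa using M.rank_le_width)
    · have h1 : IsUnit (Mᵀ * (M * C * Mᵀ) * M) := by
        have : Mᵀ * (M * C * Mᵀ) * M = (Mᵀ * M) * C * (Mᵀ * M) := by
          simp only [Matrix.mul_assoc]
        rw [this]
        exact (hMM.mul hC.isUnit).mul hMM
      calc q = (Mᵀ * (M * C * Mᵀ) * M).rank := by simp [rank_of_isUnit _ h1]
        _ ≤ _ := (rank_mul_le_left _ _).trans (rank_mul_le_right _ _)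
  have hcard : Fintype.card {i // a i - σ ≠ 0} = q := by
    rw [← rank_diagonal, ← hrank]
    refine le_antisymm ?_ ?_
    · rw [hdiag]; exact (rank_mul_le_left _ _).trans (rank_mul_le_right _ _)
    · rw [hK]; exact (rank_mul_le_left _ _).trans (rank_mul_le_right _ _)
  have hiff := ne_zero_iff_lt_of_antitone (fun i j h => sub_le_sub_right (hA.antitone h) σ)
    hpsd hcard
  refine ⟨fun i hi => ?_, fun i hi => ?_⟩
  · have := (hpsd i).lt_of_ne' ((hiff i).mpr hi)
    linarith
  · by_contra h
    exact absurd ((hiff i).mp (sub_ne_zero.mpr h)) (not_lt.mpr hi)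

/-- The noise projector of `M C Mᵀ + σ` annihilates the signal space, the range of `M`. -/
theorem noiseProjector_mul_eq_zero {σ : ℝ} {M : Matrix (Fin p) (Fin q) ℝ}
    (hM : LinearIndependent ℝ M.col) {C : Matrix (Fin q) (Fin q) ℝ} (hC : C.PosDef)
    {U : Matrix (Fin p) (Fin p) ℝ} {a : Fin p → ℝ}
    (hA : IsOrderedEigendecomposition (M * C * Mᵀ + σ • 1) U a) :
    U * diagonal (fun j : Fin p => if q ≤ (j : ℕ) then (1 : ℝ) else 0) * Uᵀ * M = 0 := by
  set Q := U * diagonal (fun j : Fin p => if q ≤ (j : ℕ) then (1 : ℝ) else 0) * Uᵀ with hQ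
  have hQK : Q * (M * C * Mᵀ) = 0 := by
    rw [← add_sub_cancel_right (M * C * Mᵀ) (σ • 1), hA.eq,
      conj_diagonal_sub_smul_one hA.orthogonal, hQ, conj_diagonal_mul hA.orthogonal]
    have : (fun i : Fin p => (if q ≤ (i : ℕ) then (1 : ℝ) else 0) * (a i - σ)) = 0 := by
      ext i
      by_cases hi : q ≤ (i : ℕ)
      · simp [(spiked_eigenvalues hM hC hA).2 i hi]
      · simp [hi]
    rw [this]; simp
  have hMM : IsUnit (C * (Mᵀ * M)) := by
    have := PosDef.conjTranspose_mul_self M (mulVec_injective_iff.mpr hM)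
    exact hC.isUnit.mul this.isUnit
  have h0 : Q * M * (C * (Mᵀ * M)) = 0 := by
    have : Q * M * (C * (Mᵀ * M)) = Q * (M * C * Mᵀ) * M := by simp only [Matrix.mul_assoc]
    rw [this, hQK, Matrix.zero_mul]
  obtain ⟨V, hV⟩ := hMM.exists_right_inv
  rw [← Matrix.mul_one (Q * M), ← hV, ← Matrix.mul_assoc, h0, Matrix.zero_mul]

end LinearAlgebra

/-! ### Fourth moments of the standard Gaussian -/

section GaussianMoments

open scoped RealInnerProductSpace

/-- The fourth derivative at `0` of the moment generating function `exp (v t² / 2)`. -/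
theorem integral_pow_four_gaussianReal (v : NNReal) :
    ∫ x, x ^ 4 ∂(gaussianReal 0 v) = 3 * v ^ 2 := by
  have h := iteratedDeriv_mgf_zero (X := id) (μ := gaussianReal 0 v) (by simp) 4
  have hd : ∀ (p p' r : ℝ → ℝ), (∀ t, HasDerivAt p (p' t) t) → (∀ t, p' t + p t * (v * t) = r t) →
      deriv (fun t => p t * Real.exp (v * t ^ 2 / 2)) =
        fun t => r t * Real.exp (v * t ^ 2 / 2) := fun p p' r hp hr => by
    ext t
    have h1 : HasDerivAt (fun t : ℝ => (v : ℝ) * t ^ 2 / 2) (v * t) t := by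
      refine (((hasDerivAt_pow 2 t).const_mul (v : ℝ)).div_const 2).congr_deriv ?_
      simp; ring
    refine ((hp t).mul h1.exp).deriv.trans ?_
    rw [← hr]; ring
  have e0 : mgf id (gaussianReal 0 v) = fun t => 1 * Real.exp (v * t ^ 2 / 2) := by
    simp [mgf_id_gaussianReal]
  have d1 := hd (fun _ => 1) (fun _ => 0) (fun t => v * t) (fun t => hasDerivAt_const t 1)
    (fun t => by ring)
  have d2 := hd (fun t => v * t) (fun _ => v) (fun t => v + v ^ 2 * t ^ 2)
    (fun t => ((hasDerivAt_id' t).const_mul (v : ℝ)).congr_deriv (by ring)) (fun t => by ring)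
  have d3 := hd (fun t => v + v ^ 2 * t ^ 2) (fun t => 2 * v ^ 2 * t)
    (fun t => 3 * v ^ 2 * t + v ^ 3 * t ^ 3)
    (fun t => (((hasDerivAt_pow 2 t).const_mul ((v : ℝ) ^ 2)).const_add (v : ℝ)).congr_deriv
      (by simp; ring)) (fun t => by ring)
  have d4 := hd (fun t => 3 * v ^ 2 * t + v ^ 3 * t ^ 3) (fun t => 3 * v ^ 2 + 3 * v ^ 3 * t ^ 2)
    (fun t => 3 * v ^ 2 + 6 * v ^ 3 * t ^ 2 + v ^ 4 * t ^ 4)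
    (fun t => (((hasDerivAt_id' t).const_mul (3 * (v : ℝ) ^ 2)).add
      ((hasDerivAt_pow 3 t).const_mul ((v : ℝ) ^ 3))).congr_deriv (by simp; ring))
    (fun t => by ring)
  simp only [e0, iteratedDeriv_succ', iteratedDeriv_zero, d1, d2, d3, d4] at h
  simpa using h.symm

variable {Ω E : Type*} [MeasurableSpace Ω] {P : Measure Ω}
  [NormedAddCommGroup E] [InnerProductSpace ℝ E] [FiniteDimensional ℝ E] [MeasurableSpace E]
  [BorelSpace E] {w : Ω → E}

theorem memLp_inner_stdGaussian (hw : HasLaw w (stdGaussian E) P) (a : E) {r : ENNReal}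
    (hr : r ≠ ⊤) : MemLp (fun ω => ⟪a, w ω⟫) r P := by
  have h := IsGaussian.memLp_dual (stdGaussian E) (innerSL ℝ a) r hr
  rw [← hw.map_eq] at h
  exact h.comp_of_map hw.aemeasurable

theorem integral_inner_stdGaussian (hw : HasLaw w (stdGaussian E) P) (a : E) :
    ∫ ω, ⟪a, w ω⟫ ∂P = 0 :=
  (hw.integral_comp (f := fun x => ⟪a, x⟫) (by fun_prop)).trans
    (integral_strongDual_stdGaussian (innerSL ℝ a))

theorem hasLaw_inner_stdGaussian (hw : HasLaw w (stdGaussian E) P) (a : E) :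
    HasLaw (fun ω => ⟪a, w ω⟫) (gaussianReal 0 (‖a‖₊ ^ 2)) P := by
  have h := IsGaussian.map_eq_gaussianReal (μ := stdGaussian E) (innerSL ℝ a)
  rw [integral_strongDual_stdGaussian, variance_dual_stdGaussian, innerSL_apply_norm] at h
  have h2 : HasLaw (innerSL ℝ a) (gaussianReal 0 (‖a‖₊ ^ 2)) (stdGaussian E) :=
    ⟨by fun_prop, by rw [h]; congr 1; ext; simp⟩
  exact h2.comp hw

theorem integral_inner_pow_four_stdGaussian (hw : HasLaw w (stdGaussian E) P) (a : E) :
    ∫ ω, ⟪a, w ω⟫ ^ 4 ∂P = 3 * ⟪a, a⟫ ^ 2 := by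
  have h := (hasLaw_inner_stdGaussian hw a).integral_comp (f := fun x : ℝ => x ^ 4) (by fun_prop)
  rw [integral_pow_four_gaussianReal] at h
  simpa [real_inner_self_eq_norm_sq, Function.comp_def] using h

theorem memLp_two_inner_mul_inner_stdGaussian (hw : HasLaw w (stdGaussian E) P) (a b : E) :
    MemLp (fun ω => ⟪a, w ω⟫ * ⟪b, w ω⟫) 2 P :=
  haveI : ENNReal.HolderTriple 4 4 2 := ⟨by
    rw [show (4 : ENNReal) = 2 * 2 by norm_num, ENNReal.mul_inv (by simp) (by simp), ← two_mul,
      ← mul_assoc, ENNReal.mul_inv_cancel (by simp) (by simp), one_mul]⟩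
  (memLp_inner_stdGaussian hw b (r := 4) (by simp)).mul'
    (memLp_inner_stdGaussian hw a (r := 4) (by simp))

theorem integrable_inner_mul_four_stdGaussian (hw : HasLaw w (stdGaussian E) P) (a b c d : E) :
    Integrable (fun ω => (⟪a, w ω⟫ * ⟪b, w ω⟫) * (⟪c, w ω⟫ * ⟪d, w ω⟫)) P :=
  (memLp_two_inner_mul_inner_stdGaussian hw a b).integrable_mul
    (memLp_two_inner_mul_inner_stdGaussian hw c d)

/-- Polarization of the fourth moment, through
`12 x² y² = (x + y)⁴ + (x - y)⁴ - 2 x⁴ - 2 y⁴`. -/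
theorem integral_inner_sq_mul_inner_sq_stdGaussian (hw : HasLaw w (stdGaussian E) P) (a b : E) :
    ∫ ω, (⟪a, w ω⟫ * ⟪a, w ω⟫) * (⟪b, w ω⟫ * ⟪b, w ω⟫) ∂P =
      ⟪a, a⟫ * ⟪b, b⟫ + 2 * ⟪a, b⟫ ^ 2 := by
  have hi := fun u : E => integrable_inner_mul_four_stdGaussian hw u u u u
  have h4 := fun u : E => integral_inner_pow_four_stdGaussian hw u
  have e : ∀ ω, (⟪a, w ω⟫ * ⟪a, w ω⟫) * (⟪b, w ω⟫ * ⟪b, w ω⟫) =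
      12⁻¹ * (⟪a + b, w ω⟫ ^ 4 + ⟪a - b, w ω⟫ ^ 4 - 2 * ⟪a, w ω⟫ ^ 4 - 2 * ⟪b, w ω⟫ ^ 4) :=
    fun ω => by rw [inner_add_left, inner_sub_left]; ring
  have hi' : ∀ u : E, Integrable (fun ω => ⟪u, w ω⟫ ^ 4) P := fun u =>
    (hi u).congr (.of_forall fun ω => by ring)
  have hadd := (hi' (a + b)).fun_add (hi' (a - b))
  have hsub : Integrable (fun ω => ⟪a + b, w ω⟫ ^ 4 + ⟪a - b, w ω⟫ ^ 4 - 2 * ⟪a, w ω⟫ ^ 4) P :=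
    hadd.sub ((hi' a).const_mul 2)
  simp_rw [e]
  rw [integral_const_mul, integral_sub hsub
    ((hi' _).const_mul _), integral_sub hadd ((hi' _).const_mul _),
    integral_add (hi' _) (hi' _), integral_const_mul, integral_const_mul, h4, h4, h4, h4]
  simp only [inner_add_left, inner_add_right, inner_sub_left, inner_sub_right,
    real_inner_comm a b]
  ring

/-- Isserlis' formula for four linear functionals of a standard Gaussian vector. -/
theorem integral_inner_mul_four_stdGaussian (hw : HasLaw w (stdGaussian E) P) (a b c d : E) :
    ∫ ω, (⟪a, w ω⟫ * ⟪b, w ω⟫) * (⟪c, w ω⟫ * ⟪d, w ω⟫) ∂P =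
      ⟪a, b⟫ * ⟪c, d⟫ + ⟪a, c⟫ * ⟪b, d⟫ + ⟪a, d⟫ * ⟪b, c⟫ := by
  have hi := integrable_inner_mul_four_stdGaussian hw
  have h2 : ∀ a c d : E, ∫ ω, (⟪a, w ω⟫ * ⟪a, w ω⟫) * (⟪c, w ω⟫ * ⟪d, w ω⟫) ∂P =
      ⟪a, a⟫ * ⟪c, d⟫ + 2 * (⟪a, c⟫ * ⟪a, d⟫) := fun a c d => by
    have e : ∀ ω, (⟪a, w ω⟫ * ⟪a, w ω⟫) * (⟪c, w ω⟫ * ⟪d, w ω⟫) =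
        4⁻¹ * ((⟪a, w ω⟫ * ⟪a, w ω⟫) * (⟪c + d, w ω⟫ * ⟪c + d, w ω⟫) -
          (⟪a, w ω⟫ * ⟪a, w ω⟫) * (⟪c - d, w ω⟫ * ⟪c - d, w ω⟫)) := fun ω => by
      rw [inner_add_left, inner_sub_left]; ring
    simp_rw [e]
    rw [integral_const_mul, integral_sub (hi _ _ _ _) (hi _ _ _ _),
      integral_inner_sq_mul_inner_sq_stdGaussian hw, integral_inner_sq_mul_inner_sq_stdGaussian hw]
    simp only [inner_add_left, inner_add_right, inner_sub_left, inner_sub_right,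
      real_inner_comm c d]
    ring
  have e : ∀ ω, (⟪a, w ω⟫ * ⟪b, w ω⟫) * (⟪c, w ω⟫ * ⟪d, w ω⟫) =
      4⁻¹ * ((⟪a + b, w ω⟫ * ⟪a + b, w ω⟫) * (⟪c, w ω⟫ * ⟪d, w ω⟫) -
        (⟪a - b, w ω⟫ * ⟪a - b, w ω⟫) * (⟪c, w ω⟫ * ⟪d, w ω⟫)) := fun ω => by
    rw [inner_add_left, inner_sub_left]; ring
  simp_rw [e]
  rw [integral_const_mul, integral_sub (hi _ _ _ _) (hi _ _ _ _), h2, h2]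
  simp only [inner_add_left, inner_add_right, inner_sub_left, inner_sub_right,
    real_inner_comm a b]
  ring

variable [IsProbabilityMeasure P]

theorem integral_inner_mul_inner_stdGaussian (hw : HasLaw w (stdGaussian E) P) (a b : E) :
    ∫ ω, ⟪a, w ω⟫ * ⟪b, w ω⟫ ∂P = ⟪a, b⟫ := by
  have h := covarianceBilin_apply_eq_cov (μ := stdGaussian E) IsGaussian.memLp_two_id a b
  rw [covarianceBilin_stdGaussian, innerSL_apply_apply, ← hw.covariance_fun_comp (by fun_prop)
    (by fun_prop), covariance_eq_sub (memLp_inner_stdGaussian hw a (by simp))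
    (memLp_inner_stdGaussian hw b (by simp)), integral_inner_stdGaussian hw, zero_mul,
    sub_zero] at h
  exact h.symm

theorem covariance_inner_mul_inner_stdGaussian (hw : HasLaw w (stdGaussian E) P) (a b c d : E) :
    cov[fun ω => ⟪a, w ω⟫ * ⟪b, w ω⟫, fun ω => ⟪c, w ω⟫ * ⟪d, w ω⟫; P] =
      ⟪a, c⟫ * ⟪b, d⟫ + ⟪a, d⟫ * ⟪b, c⟫ := by
  rw [covariance_eq_sub (memLp_two_inner_mul_inner_stdGaussian hw a b)
    (memLp_two_inner_mul_inner_stdGaussian hw c d), integral_inner_mul_inner_stdGaussian hw,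
    integral_inner_mul_inner_stdGaussian hw]
  refine (congrArg (· - _) (integral_inner_mul_four_stdGaussian hw a b c d)).trans ?_
  ring

end GaussianMoments

/-! ### Limit theorems -/

section LimitTheorems

open scoped RealInnerProductSpace Topology

variable {Ω : Type*} [MeasurableSpace Ω] {P : Measure Ω}

theorem _root_.ProbabilityTheory.IndepFun.memLp_two_mul {f g : Ω → ℝ} (h : IndepFun f g P)
    (hf : MemLp f 2 P) (hg : MemLp g 2 P) : MemLp (fun ω => f ω * g ω) 2 P := by
  refine (memLp_two_iff_integrable_sq (hf.1.mul hg.1)).2 ?_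
  have h2 := (h.comp (φ := fun x : ℝ => x ^ 2) (ψ := fun x : ℝ => x ^ 2) (by fun_prop)
    (by fun_prop)).integrable_mul hf.integrable_sq hg.integrable_sq
  exact h2.congr (.of_forall fun ω => by simp [mul_pow])

/-- If `‖D n‖ ≤ Z n` holds wherever `|B n| < ε`, and `B` and `Z` tend to `0` in measure, then so
does `D`. -/
theorem tendstoInMeasure_zero_of_dominated {E : Type*} [NormedAddCommGroup E] {D : ℕ → Ω → E}
    {B Z : ℕ → Ω → ℝ} {ε : ℝ} (hε : 0 < ε) (hB : TendstoInMeasure P B atTop 0)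
    (hZ : TendstoInMeasure P Z atTop 0)
    (h : ∀ n, ∀ᵐ ω ∂P, |B n ω| < ε → ‖D n ω‖ ≤ Z n ω) : TendstoInMeasure P D atTop 0 := by
  rw [tendstoInMeasure_iff_norm] at hB hZ ⊢
  intro δ hδ
  have hlim := (hB ε hε).add (hZ δ hδ)
  rw [add_zero] at hlim
  refine tendsto_of_tendsto_of_tendsto_of_le_of_le tendsto_const_nhds hlim (fun n => zero_le)
    fun n => ?_
  refine (measure_mono_ae ?_).trans (measure_union_le _ _)
  filter_upwards [h n] with ω hω hD
  simp only [Pi.zero_apply, sub_zero, Real.norm_eq_abs] at hD ⊢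
  by_cases hb : |B n ω| < ε
  · exact Or.inr (le_trans hD ((hω hb).trans (le_abs_self _)))
  · exact Or.inl (not_lt.mp hb)

theorem tendstoInMeasure_zero_of_integral {Z : ℕ → Ω → ℝ} (hZ : ∀ n ω, 0 ≤ Z n ω)
    (hi : ∀ n, Integrable (Z n) P) (h : Tendsto (fun n => ∫ ω, Z n ω ∂P) atTop (𝓝 0)) :
    TendstoInMeasure P Z atTop 0 := by
  refine tendstoInMeasure_of_tendsto_eLpNorm one_ne_zero (fun n => (hi n).1)
    aestronglyMeasurable_zero ?_
  have : ∀ n, eLpNorm (Z n - 0) 1 P = ENNReal.ofReal (∫ ω, Z n ω ∂P) := fun n => by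
    rw [sub_zero, eLpNorm_one_eq_lintegral_enorm,
      ofReal_integral_eq_lintegral_ofReal (hi n) (.of_forall (hZ n))]
    exact lintegral_congr fun ω => Real.enorm_of_nonneg (hZ n ω)
  simp_rw [this]
  simpa using ENNReal.tendsto_ofReal h

variable [IsProbabilityMeasure P]

/-- The mean of `n` centered, independent and identically distributed variables has second moment
`Var / n`; for `n = 0` both sides are `0`. -/
theorem integral_sq_mean {f : ℕ → Ω → ℝ} (hf : MemLp (f 0) 2 P) (h0 : ∫ ω, f 0 ω ∂P = 0)
    (hindep : iIndepFun f P) (hident : ∀ i, IdentDistrib (f i) (f 0) P P) (n : ℕ) :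
    MemLp (fun ω => (n : ℝ)⁻¹ * ∑ i ∈ Finset.range n, f i ω) 2 P ∧
    ∫ ω, ((n : ℝ)⁻¹ * ∑ i ∈ Finset.range n, f i ω) ^ 2 ∂P = (n : ℝ)⁻¹ * Var[f 0; P] := by
  have hfi : ∀ i, MemLp (f i) 2 P := fun i => (hident i).symm.memLp_snd hf
  have hm : MemLp (fun ω => ∑ i ∈ Finset.range n, f i ω) 2 P :=
    memLp_finsetSum _ fun i _ => hfi i
  refine ⟨hm.const_mul _, ?_⟩
  have hsum : ∫ ω, ∑ i ∈ Finset.range n, f i ω ∂P = 0 := by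
    rw [integral_finsetSum _ fun i _ => (hfi i).integrable (by simp)]
    exact Finset.sum_eq_zero fun i _ => by rw [(hident i).integral_eq, h0]
  have hv : ∫ ω, (∑ i ∈ Finset.range n, f i ω) ^ 2 ∂P = n * Var[f 0; P] := by
    rw [← variance_of_integral_eq_zero hm.1.aemeasurable hsum]
    have := IndepFun.variance_sum (X := f) (s := Finset.range n) (fun i _ => hfi i)
      (fun i _ j _ hij => hindep.indepFun hij)
    rw [show (fun ω => ∑ i ∈ Finset.range n, f i ω) = ∑ i ∈ Finset.range n, f i by ext; simp, this]
    simp [fun i => (hident i).variance_eq]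
  simp_rw [mul_pow]
  rw [integral_const_mul, hv]
  rcases eq_or_ne n 0 with rfl | hn
  · simp
  · field_simp

variable {ι : Type*} [Fintype ι]

theorem dotProduct_covariance_mulVec {X : Ω → EuclideanSpace ℝ ι} (hX : MemLp X 2 P)
    {V : Matrix ι ι ℝ} (hV : ∀ j k, cov[fun ω => X ω j, fun ω => X ω k; P] = V j k) (t : ι → ℝ) :
    t ⬝ᵥ V *ᵥ t = Var[fun ω => ∑ j, t j * X ω j; P] := by
  have hXj : ∀ j, MemLp (fun ω => X ω j) 2 P := fun j =>
    (EuclideanSpace.proj (𝕜 := ℝ) j).comp_memLp' hX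
  rw [← covariance_self (by
      exact Finset.aemeasurable_fun_sum _ fun j _ => (hXj j).1.aemeasurable.const_mul _),
    covariance_fun_sum_fun_sum (fun j => (hXj j).const_mul _) (fun j => (hXj j).const_mul _)]
  simp only [dotProduct, mulVec, Finset.mul_sum, covariance_const_mul_left,
    covariance_const_mul_right, hV]
  exact Finset.sum_congr rfl fun i _ => Finset.sum_congr rfl fun j _ => by ring

theorem posSemidef_of_covariance {X : Ω → EuclideanSpace ℝ ι} (hX : MemLp X 2 P)
    {V : Matrix ι ι ℝ} (hV : ∀ j k, cov[fun ω => X ω j, fun ω => X ω k; P] = V j k) :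
    V.PosSemidef := by
  refine PosSemidef.of_dotProduct_mulVec_nonneg ?_ fun t => ?_
  · ext j k
    rw [conjTranspose_apply, star_trivial, ← hV, ← hV, covariance_comm]
  · rw [star_trivial, dotProduct_covariance_mulVec hX hV]
    exact variance_nonneg _ _

/-- The central limit theorem for square-integrable random vectors, obtained from the real one by
comparing characteristic functions at `t` with those of the projections on `t` at `1`. -/
theorem tendstoInDistribution_multivariateGaussian [DecidableEq ι] {X : ℕ → Ω → EuclideanSpace ℝ ι}
    (hX : MemLp (X 0) 2 P) (h0 : ∀ j, ∫ ω, X 0 ω j ∂P = 0) {V : Matrix ι ι ℝ}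
    (hV : ∀ j k, cov[fun ω => X 0 ω j, fun ω => X 0 ω k; P] = V j k)
    (hindep : iIndepFun X P) (hident : ∀ i, IdentDistrib (X i) (X 0) P P) :
    TendstoInDistribution (fun (n : ℕ) ω => (√n)⁻¹ • ∑ i ∈ Finset.range n, X i ω) atTop
      (fun z : EuclideanSpace ℝ ι => z) (fun _ => P) (multivariateGaussian 0 V) where
  forall_aemeasurable n :=
    (Finset.aemeasurable_fun_sum _ fun i _ => (hident i).aemeasurable_fst).const_smul (√(n : ℝ))⁻¹
  tendsto := by
    refine ProbabilityMeasure.tendsto_iff_tendsto_charFun.2 fun t => ?_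
    have hXj : ∀ j, MemLp (fun ω => X 0 ω j) 2 P := fun j =>
      (EuclideanSpace.proj (𝕜 := ℝ) j).comp_memLp' hX
    let Y : ℕ → Ω → ℝ := fun i ω => ∑ j, t j * X i ω j
    have hYL : MemLp (Y 0) 2 P := memLp_finsetSum _ fun j _ => (hXj j).const_mul _
    have hg : Measurable fun x : EuclideanSpace ℝ ι => ∑ j, t j * x j := by fun_prop
    have hYindep : iIndepFun Y P := hindep.comp (fun _ x => ∑ j, t j * x j) fun _ => hg
    have hYident : ∀ i, IdentDistrib (Y i) (Y 0) P P := fun i => (hident i).comp hg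
    have hY0 : ∫ ω, Y 0 ω ∂P = 0 := by
      simp only [Y]
      rw [integral_finsetSum _ fun j _ => ((hXj j).const_mul _).integrable (by simp)]
      exact Finset.sum_eq_zero fun j _ => by rw [integral_const_mul, h0, mul_zero]
    have hclt := (tendstoInDistribution_inv_sqrt_mul_sum_sub
      (HasLaw.id (μ := gaussianReal 0 Var[Y 0; P].toNNReal)) hYL hYindep hYident).tendsto
    have hc := ProbabilityMeasure.tendsto_iff_tendsto_charFun.1 hclt 1
    have hvar := dotProduct_covariance_mulVec hX hV t
    simp only [ProbabilityMeasure.coe_mk, Measure.map_id, Measure.map_id'] at hc ⊢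
    rw [charFun_gaussianReal] at hc
    rw [charFun_multivariateGaussian (posSemidef_of_covariance hX hV), hvar]
    have hXm : ∀ n : ℕ, AEMeasurable (fun ω => (√n)⁻¹ • ∑ i ∈ Finset.range n, X i ω) P := fun n =>
      (Finset.aemeasurable_fun_sum _ fun i _ => (hident i).aemeasurable_fst).const_smul (√(n : ℝ))⁻¹
    have hYm : ∀ n : ℕ, AEMeasurable
        (fun ω => (√n)⁻¹ * (∑ i ∈ Finset.range n, Y i ω - n * ∫ ω, Y 0 ω ∂P)) P := fun n =>
      ((Finset.aemeasurable_fun_sum _ fun i _ => (hYident i).aemeasurable_fst).sub_const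
        _).const_mul _
    convert hc using 2 with n
    · rw [charFun_apply, charFun_apply, integral_map (hXm n) (by fun_prop),
        integral_map (hYm n) (by fun_prop)]
      congr 1
      ext ω
      congr 3
      rw [hY0, real_inner_smul_left, sum_inner]
      simp [Y, PiLp.inner_apply]
    · simp [variance_nonneg, Y]

end LimitTheorems

/-! ### Moments of the observations -/

section Model

open scoped RealInnerProductSpace

variable {p q : ℕ}

/-- A random vector of the model: the signal `M s` plus white noise of variance `σ`. -/
noncomputable def observation {Ω : Type*} (M : Matrix (Fin p) (Fin q) ℝ) (σ : ℝ)
    (s : Ω → EuclideanSpace ℝ (Fin q)) (w : Ω → EuclideanSpace ℝ (Fin p)) (ω : Ω) :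
    EuclideanSpace ℝ (Fin p) :=
  WithLp.toLp 2 (M *ᵥ s ω) + √σ • w ω

theorem observation_apply {Ω : Type*} (M : Matrix (Fin p) (Fin q) ℝ) (σ : ℝ)
    (s : Ω → EuclideanSpace ℝ (Fin q)) (w : Ω → EuclideanSpace ℝ (Fin p)) (ω : Ω) (j : Fin p) :
    observation M σ s w ω j =
      (M *ᵥ s ω) j + √σ * ⟪(EuclideanSpace.single j 1 : EuclideanSpace ℝ (Fin p)), w ω⟫ := by
  simp [observation, EuclideanSpace.inner_single_left]

/-- A projector that annihilates `M` removes the signal, and what is left is Gaussian. -/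
theorem mulVec_observation {Ω : Type*} {Q : Matrix (Fin p) (Fin p) ℝ}
    {M : Matrix (Fin p) (Fin q) ℝ} (hQM : Q * M = 0) (σ : ℝ)
    (s : Ω → EuclideanSpace ℝ (Fin q)) (w : Ω → EuclideanSpace ℝ (Fin p)) (ω : Ω) (j : Fin p) :
    (Q *ᵥ observation M σ s w ω) j = √σ * ⟪WithLp.toLp 2 (Q j), w ω⟫ := by
  simp only [observation, WithLp.ofLp_add, WithLp.ofLp_smul, mulVec_add, mulVec_mulVec, hQM,
    zero_mulVec, zero_add, mulVec_smul, Pi.smul_apply, smul_eq_mul]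
  simp [PiLp.inner_apply, mulVec, dotProduct, mul_comm]

theorem inner_toLp_row {Q : Matrix (Fin p) (Fin p) ℝ} (hQt : Qᵀ = Q) (hQ : Q * Q = Q)
    (j k : Fin p) :
    ⟪(WithLp.toLp 2 (Q j) : EuclideanSpace ℝ (Fin p)), WithLp.toLp 2 (Q k)⟫ = Q j k := by
  conv_rhs => rw [← hQ, mul_apply]
  simp only [PiLp.inner_apply]
  refine Finset.sum_congr rfl fun i _ => ?_
  rw [show Q i k = Q k i from congrFun (congrFun hQt k) i]
  simp [mul_comm]

variable {Ω : Type*} [MeasurableSpace Ω] {P : Measure Ω}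
  {M : Matrix (Fin p) (Fin q) ℝ} {σ : ℝ} {s : Ω → EuclideanSpace ℝ (Fin q)}
  {w : Ω → EuclideanSpace ℝ (Fin p)}

theorem memLp_mulVec_apply (hs : MemLp s 2 P) (j : Fin p) :
    MemLp (fun ω => (M *ᵥ s ω) j) 2 P := by
  simp only [mulVec, dotProduct]
  exact memLp_finsetSum _ fun k _ =>
    ((EuclideanSpace.proj (𝕜 := ℝ) k).comp_memLp' hs).const_mul _

theorem indepFun_mulVec_inner (hsw : IndepFun s w P) (j : Fin p) (a : EuclideanSpace ℝ (Fin p)) :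
    IndepFun (fun ω => (M *ᵥ s ω) j) (fun ω => ⟪a, w ω⟫) P := by
  refine hsw.comp (φ := fun y : EuclideanSpace ℝ (Fin q) => (M *ᵥ y) j) (ψ := fun y => ⟪a, y⟫)
    ?_ (by fun_prop)
  simp only [mulVec, dotProduct]
  fun_prop

theorem memLp_observation_apply (hs : MemLp s 2 P)
    (hw : HasLaw w (stdGaussian (EuclideanSpace ℝ (Fin p))) P) (j : Fin p) :
    MemLp (fun ω => observation M σ s w ω j) 2 P := by
  simp only [observation_apply]
  exact (memLp_mulVec_apply hs j).add ((memLp_inner_stdGaussian hw _ (by simp)).const_mul _)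

/-- Products of a noise coordinate and an arbitrary coordinate are square integrable even though `s`
has only second moments: the signal enters at most linearly, and it is independent of the noise. -/
theorem memLp_mulVec_observation_mul (hs : MemLp s 2 P)
    (hw : HasLaw w (stdGaussian (EuclideanSpace ℝ (Fin p))) P) (hsw : IndepFun s w P)
    {Q : Matrix (Fin p) (Fin p) ℝ} (hQM : Q * M = 0) (j k : Fin p) :
    MemLp (fun ω => (Q *ᵥ observation M σ s w ω) j * observation M σ s w ω k) 2 P := by
  have h1 := (((indepFun_mulVec_inner (M := M) hsw k (WithLp.toLp 2 (Q j))).memLp_two_mul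
    (memLp_mulVec_apply hs k) (memLp_inner_stdGaussian hw _ (by simp))).const_mul √σ).add
    ((memLp_two_inner_mul_inner_stdGaussian hw (WithLp.toLp 2 (Q j))
      (EuclideanSpace.single k 1)).const_mul (√σ * √σ))
  refine (memLp_congr_ae (.of_forall fun ω => ?_)).mp h1
  simp only [mulVec_observation hQM, observation_apply, Pi.add_apply]
  ring

variable [IsProbabilityMeasure P]

theorem integral_mulVec_apply (hs : MemLp s 2 P) (hs0 : ∫ ω, s ω ∂P = 0) (j : Fin p) :
    ∫ ω, (M *ᵥ s ω) j ∂P = 0 := by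
  have hsk : ∀ k, Integrable (fun ω => s ω k) P := fun k =>
    ((EuclideanSpace.proj (𝕜 := ℝ) k).comp_memLp' hs).integrable (by simp)
  have h0 : ∀ k, ∫ ω, s ω k ∂P = 0 := fun k => by
    have := (EuclideanSpace.proj (𝕜 := ℝ) k).integral_comp_comm (hs.integrable (by simp))
    simpa [hs0] using this
  simp only [mulVec, dotProduct]
  rw [integral_finsetSum _ fun k _ => (hsk k).const_mul _]
  exact Finset.sum_eq_zero fun k _ => by rw [integral_const_mul, h0, mul_zero]

theorem integral_observation_apply (hs : MemLp s 2 P) (hs0 : ∫ ω, s ω ∂P = 0)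
    (hw : HasLaw w (stdGaussian (EuclideanSpace ℝ (Fin p))) P) (j : Fin p) :
    ∫ ω, observation M σ s w ω j ∂P = 0 := by
  simp only [observation_apply]
  rw [integral_add ((memLp_mulVec_apply hs j).integrable (by simp))
    (((memLp_inner_stdGaussian hw _ (r := 2) (by simp)).integrable (by simp)).const_mul _),
    integral_mulVec_apply hs hs0, integral_const_mul, integral_inner_stdGaussian hw]
  simp

theorem covariance_observation (hσ : 0 ≤ σ) (hs : MemLp s 2 P)
    (hw : HasLaw w (stdGaussian (EuclideanSpace ℝ (Fin p))) P) (hsw : IndepFun s w P)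
    (j k : Fin p) :
    cov[fun ω => observation M σ s w ω j, fun ω => observation M σ s w ω k; P] =
      (M * covMatrix s P * Mᵀ + σ • 1 : Matrix (Fin p) (Fin p) ℝ) j k := by
  have hW : ∀ a, MemLp (fun ω => √σ * ⟪a, w ω⟫) 2 P := fun a =>
    (memLp_inner_stdGaussian hw a (by simp)).const_mul _
  have hS : ∀ j, MemLp (fun ω => (M *ᵥ s ω) j) 2 P := memLp_mulVec_apply hs
  have hsk : ∀ k, MemLp (fun ω => s ω k) 2 P := fun k =>
    (EuclideanSpace.proj (𝕜 := ℝ) k).comp_memLp' hs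
  have hcross : ∀ j a, cov[fun ω => (M *ᵥ s ω) j, fun ω => √σ * ⟪a, w ω⟫; P] = 0 := fun j a => by
    rw [covariance_const_mul_right, (indepFun_mulVec_inner hsw j a).covariance_eq_zero (hS j)
      (memLp_inner_stdGaussian hw a (by simp)), mul_zero]
  have hSS : cov[fun ω => (M *ᵥ s ω) j, fun ω => (M *ᵥ s ω) k; P] =
      (M * covMatrix s P * Mᵀ) j k := by
    simp only [mulVec, dotProduct]
    rw [covariance_fun_sum_fun_sum (fun i => (hsk i).const_mul _) (fun i => (hsk i).const_mul _)]
    simp only [covariance_const_mul_left, covariance_const_mul_right, mul_apply, transpose_apply,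
      covMatrix, of_apply, Finset.sum_mul]
    rw [Finset.sum_comm]
    exact Finset.sum_congr rfl fun _ _ => Finset.sum_congr rfl fun _ _ => by ring
  have hWW : ∀ a b, cov[fun ω => √σ * ⟪a, w ω⟫, fun ω => √σ * ⟪b, w ω⟫; P] = σ * ⟪a, b⟫ :=
    fun a b => by
      rw [covariance_const_mul_left, covariance_const_mul_right, covariance_eq_sub
        (memLp_inner_stdGaussian hw a (by simp)) (memLp_inner_stdGaussian hw b (by simp)),
        integral_inner_stdGaussian hw, zero_mul, sub_zero, ← mul_assoc, Real.mul_self_sqrt hσ]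
      exact congrArg _ (integral_inner_mul_inner_stdGaussian hw a b)
  have hadd : ∀ j, (fun ω => observation M σ s w ω j) = (fun ω => (M *ᵥ s ω) j) +
      fun ω => √σ * ⟪(EuclideanSpace.single j 1 : EuclideanSpace ℝ (Fin p)), w ω⟫ := fun j => by
    ext ω; exact observation_apply _ _ _ _ _ _
  rw [hadd, hadd, covariance_add_left (hS _) (hW _) ((hS _).add (hW _)),
    covariance_add_right (hS _) (hS _) (hW _), covariance_add_right (hW _) (hS _) (hW _),
    hcross, covariance_comm (fun ω => √σ * _), hcross, hSS, hWW]
  simp [EuclideanSpace.inner_single_left, one_apply]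

theorem integral_mulVec_observation_mul (hσ : 0 ≤ σ) (hs : MemLp s 2 P) (hs0 : ∫ ω, s ω ∂P = 0)
    (hw : HasLaw w (stdGaussian (EuclideanSpace ℝ (Fin p))) P) (hsw : IndepFun s w P)
    {Q : Matrix (Fin p) (Fin p) ℝ} (hQM : Q * M = 0) (j k : Fin p) :
    ∫ ω, (Q *ᵥ observation M σ s w ω) j * observation M σ s w ω k ∂P = σ * Q j k := by
  have hO := fun j => memLp_observation_apply (M := M) (σ := σ) hs hw j
  have hprod : ∀ i, Integrable (fun ω => Q j i *
      (observation M σ s w ω i * observation M σ s w ω k)) P :=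
    fun i => ((hO i).integrable_mul (hO k)).const_mul _
  have hcov := fun i => covariance_observation (M := M) hσ hs hw hsw i k
  simp only [covariance_eq_sub (hO _) (hO _), integral_observation_apply hs hs0 hw, zero_mul,
    sub_zero] at hcov
  simp only [mulVec, dotProduct, Finset.sum_mul, mul_assoc]
  rw [integral_finsetSum _ fun i _ => hprod i]
  have : ∀ i, ∫ ω, Q j i * (observation M σ s w ω i * observation M σ s w ω k) ∂P =
      Q j i * (M * covMatrix s P * Mᵀ + σ • 1 : Matrix (Fin p) (Fin p) ℝ) i k := fun i => by
    rw [integral_const_mul]; exact congrArg _ (hcov i)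
  simp_rw [this, ← mul_apply]
  rw [Matrix.mul_add, ← Matrix.mul_assoc, ← Matrix.mul_assoc, hQM]
  simp

theorem covariance_mulVec_observation_mul (hσ : 0 ≤ σ)
    (hw : HasLaw w (stdGaussian (EuclideanSpace ℝ (Fin p))) P)
    {Q : Matrix (Fin p) (Fin p) ℝ} (hQt : Qᵀ = Q) (hQ : Q * Q = Q) (hQM : Q * M = 0)
    (a b c d : Fin p) :
    cov[fun ω => (Q *ᵥ observation M σ s w ω) a * (Q *ᵥ observation M σ s w ω) b,
        fun ω => (Q *ᵥ observation M σ s w ω) c * (Q *ᵥ observation M σ s w ω) d; P] =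
      σ ^ 2 * (Q a c * Q b d + Q a d * Q b c) := by
  have e : ∀ a b, (fun ω => (Q *ᵥ observation M σ s w ω) a * (Q *ᵥ observation M σ s w ω) b) =
      fun ω => σ * (⟪WithLp.toLp 2 (Q a), w ω⟫ * ⟪WithLp.toLp 2 (Q b), w ω⟫) := fun a b => by
    ext ω
    rw [mulVec_observation hQM, mulVec_observation hQM, mul_mul_mul_comm, Real.mul_self_sqrt hσ]
  rw [e, e, covariance_const_mul_left, covariance_const_mul_right,
    covariance_inner_mul_inner_stdGaussian hw]
  simp only [inner_toLp_row hQt hQ]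
  ring

/-- The entries of `(Q ⊗ Q)(I + P)(A ⊗ A)(Q ⊗ Q)` when `A` acts as `σ` on the range of `Q`. -/
theorem noiseAsymptoticCov_apply {Q A : Matrix (Fin p) (Fin p) ℝ}
    (hQ : Q * Q = Q) (hAQ : A * Q = σ • Q) (x y : Fin p × Fin p) :
    noiseAsymptoticCov Q A x y =
      σ ^ 2 * (Q x.1 y.1 * Q x.2 y.2 + Q x.2 y.1 * Q x.1 y.2) := by
  have h1 : noiseAsymptoticCov Q A =
      σ ^ 2 • ((Q ⊗ₖ Q) * (Q ⊗ₖ Q) + (Q ⊗ₖ Q) * transpositionMatrix p * (Q ⊗ₖ Q)) := by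
    rw [noiseAsymptoticCov, fullAsymptoticCov]
    simp only [Matrix.mul_assoc]
    rw [← mul_kronecker_mul, hAQ, smul_kronecker, kronecker_smul, smul_smul, ← sq]
    simp only [Matrix.mul_smul, Matrix.add_mul, Matrix.mul_add, Matrix.one_mul]
  have h2 : (Q ⊗ₖ Q) * transpositionMatrix p = (Q ⊗ₖ Q).submatrix Prod.swap id := by
    ext x y
    simp only [mul_apply, transpositionMatrix, of_apply, submatrix_apply, id]
    simp [kroneckerMap_apply, mul_comm]
  have h3 : (Q ⊗ₖ Q).submatrix Prod.swap id * (Q ⊗ₖ Q) =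
      ((Q ⊗ₖ Q) * (Q ⊗ₖ Q)).submatrix Prod.swap id := by
    ext x y; simp [mul_apply]
  rw [h1, h2, h3, ← mul_kronecker_mul, hQ]
  simp [kroneckerMap_apply]

end Model

/-! ### Statistics of the sample covariance matrix -/

section Assembly

open scoped Topology

variable {p q : ℕ} {σ : ℝ}

theorem mul_vecMulVec_self_apply (Q : Matrix (Fin p) (Fin p) ℝ) (v : Fin p → ℝ) (j k : Fin p) :
    (Q * (vecMulVec v v - σ • 1)) j k = (Q *ᵥ v) j * v k - σ * Q j k := by
  simp [Matrix.mul_sub, mul_vecMulVec, vecMulVec_apply]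

theorem mul_vecMulVec_self_mul_apply {Q : Matrix (Fin p) (Fin p) ℝ} (hQt : Qᵀ = Q)
    (hQ : Q * Q = Q) (v : Fin p → ℝ) (j k : Fin p) :
    (Q * (vecMulVec v v - σ • 1) * Q) j k = (Q *ᵥ v) j * (Q *ᵥ v) k - σ * Q j k := by
  simp [Matrix.mul_sub, Matrix.sub_mul, mul_vecMulVec, vecMulVec_mul, vecMulVec_apply, hQ,
    ← mulVec_transpose, hQt]

theorem sampleCov_sub_smul_one {Ω : Type*} (x : ℕ → Ω → EuclideanSpace ℝ (Fin p)) {n : ℕ}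
    (hn : n ≠ 0) (ω : Ω) :
    sampleCov x n ω - σ • 1 =
      (n : ℝ)⁻¹ • ∑ i ∈ Finset.range n, (vecMulVec (x i ω) (x i ω) - σ • 1) := by
  rw [Finset.sum_sub_distrib, smul_sub, sampleCov, Finset.sum_const, Finset.card_range,
    ← Nat.cast_smul_eq_nsmul ℝ, smul_smul, smul_smul, inv_mul_cancel₀ (by simpa), one_mul]

/-- The contribution `vec (Q (x xᵀ - σ I) Q)` of one observation `x` to the compressed sample
covariance matrix. -/
noncomputable def noiseSummand (σ : ℝ) (Q : Matrix (Fin p) (Fin p) ℝ)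
    (x : EuclideanSpace ℝ (Fin p)) : EuclideanSpace ℝ (Fin p × Fin p) :=
  WithLp.toLp 2 (Q * (vecMulVec x x - σ • 1) * Q).vec

theorem noiseSummand_apply {Q : Matrix (Fin p) (Fin p) ℝ} (hQt : Qᵀ = Q) (hQ : Q * Q = Q)
    (x : EuclideanSpace ℝ (Fin p)) (a : Fin p × Fin p) :
    noiseSummand σ Q x a = (Q *ᵥ x) a.2 * (Q *ᵥ x) a.1 - σ * Q a.2 a.1 :=
  mul_vecMulVec_self_mul_apply hQt hQ _ _ _

theorem measurable_noiseSummand {Q : Matrix (Fin p) (Fin p) ℝ} (hQt : Qᵀ = Q) (hQ : Q * Q = Q) :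
    Measurable (noiseSummand σ Q) := by
  have : noiseSummand σ Q = fun x : EuclideanSpace ℝ (Fin p) =>
      WithLp.toLp 2 fun a : Fin p × Fin p => (Q *ᵥ x) a.2 * (Q *ᵥ x) a.1 - σ * Q a.2 a.1 := by
    ext x a; exact noiseSummand_apply hQt hQ x a
  rw [this]
  simp only [mulVec, dotProduct]
  fun_prop

theorem sqrt_smul_vec_compression {Ω : Type*} (x : ℕ → Ω → EuclideanSpace ℝ (Fin p))
    (Q : Matrix (Fin p) (Fin p) ℝ) (n : ℕ) (ω : Ω) :
    WithLp.toLp 2 (√(n : ℝ) • (Q * (sampleCov x n ω - σ • 1) * Q).vec) =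
      (√(n : ℝ))⁻¹ • ∑ i ∈ Finset.range n, noiseSummand σ Q (x i ω) := by
  rcases eq_or_ne n 0 with rfl | hn
  · simp
  · have h : √(n : ℝ) * (n : ℝ)⁻¹ = (√(n : ℝ))⁻¹ := by
      rw [← div_eq_mul_inv, Real.sqrt_div_self]
    rw [sampleCov_sub_smul_one x hn, Matrix.mul_smul, Matrix.smul_mul, Matrix.mul_sum,
      Matrix.sum_mul, ← h]
    ext a
    simp [noiseSummand, vec, Matrix.sum_apply, mul_assoc]

theorem mul_sampleCov_sub_apply {Ω : Type*} (x : ℕ → Ω → EuclideanSpace ℝ (Fin p))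
    (Q : Matrix (Fin p) (Fin p) ℝ) {n : ℕ} (hn : n ≠ 0) (ω : Ω) (j k : Fin p) :
    (Q * (sampleCov x n ω - σ • 1)) j k =
      (n : ℝ)⁻¹ * ∑ i ∈ Finset.range n, ((Q *ᵥ x i ω) j * x i ω k - σ * Q j k) := by
  rw [sampleCov_sub_smul_one x hn, Matrix.mul_smul, Matrix.mul_sum, Matrix.smul_apply,
    Matrix.sum_apply, smul_eq_mul]
  simp only [mul_vecMulVec_self_apply]

variable {Ω : Type*} [MeasurableSpace Ω] {P : Measure Ω}

theorem aemeasurable_matrix_mul {A B : Ω → Matrix (Fin p) (Fin p) ℝ}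
    (hA : ∀ j k, AEMeasurable (fun ω => A ω j k) P) (hB : ∀ j k, AEMeasurable (fun ω => B ω j k) P)
    (j k : Fin p) : AEMeasurable (fun ω => (A ω * B ω) j k) P := by
  simp only [mul_apply]
  exact Finset.aemeasurable_fun_sum _ fun i _ => (hA j i).mul (hB i k)

theorem aemeasurable_sampleCov_apply {x : ℕ → Ω → EuclideanSpace ℝ (Fin p)}
    (hx : ∀ i, AEMeasurable (x i) P) (n : ℕ) (j k : Fin p) :
    AEMeasurable (fun ω => sampleCov x n ω j k) P := by
  have hm : ∀ i j, AEMeasurable (fun ω => x i ω j) P := fun i j =>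
    (EuclideanSpace.proj (𝕜 := ℝ) j).measurable.comp_aemeasurable (hx i)
  simp only [sampleCov, Matrix.smul_apply, Matrix.sum_apply, vecMulVec_apply, smul_eq_mul]
  exact (Finset.aemeasurable_fun_sum _ fun i _ => (hm i j).mul (hm i k)).const_mul _

variable [IsProbabilityMeasure P]

/-- `√n` times the squared norm of a mean of centered, square-integrable vectors vanishes in the
limit, since its expectation is of order `n^(-1/2)`. -/
theorem tendstoInMeasure_sqrt_mul_sum_sq_mean {E κ : Type*} [MeasurableSpace E] [Fintype κ]
    {x : ℕ → Ω → E} (hindep : iIndepFun x P) (hident : ∀ i, IdentDistrib (x i) (x 0) P P)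
    {g : κ → E → ℝ} (hg : ∀ a, Measurable (g a)) (hL2 : ∀ a, MemLp (fun ω => g a (x 0 ω)) 2 P)
    (h0 : ∀ a, ∫ ω, g a (x 0 ω) ∂P = 0) {C : ℝ} (hC : 0 ≤ C) :
    TendstoInMeasure P (fun (n : ℕ) ω =>
      C * (√n * ∑ a, ((n : ℝ)⁻¹ * ∑ i ∈ Finset.range n, g a (x i ω)) ^ 2)) atTop 0 := by
  have h := fun a (n : ℕ) => integral_sq_mean (f := fun i ω => g a (x i ω)) (hL2 a) (h0 a)
    (hindep.comp (fun _ => g a) fun _ => hg a) (fun i => (hident i).comp (hg a)) n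
  have hi : ∀ a (n : ℕ), Integrable
      (fun ω => ((n : ℝ)⁻¹ * ∑ i ∈ Finset.range n, g a (x i ω)) ^ 2) P :=
    fun a n => (h a n).1.integrable_sq
  refine tendstoInMeasure_zero_of_integral (fun n ω => by positivity)
    (fun n => ((integrable_finsetSum _ fun a _ => hi a n).const_mul _).const_mul _) ?_
  have he : ∀ n : ℕ, ∫ ω, C * (√n * ∑ a, ((n : ℝ)⁻¹ *
      ∑ i ∈ Finset.range n, g a (x i ω)) ^ 2) ∂P =
      (√n)⁻¹ * (C * ∑ a, Var[fun ω => g a (x 0 ω); P]) := fun n => by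
    have hn : √(n : ℝ) * (n : ℝ)⁻¹ = (√(n : ℝ))⁻¹ := by
      rw [← div_eq_mul_inv, Real.sqrt_div_self]
    rw [integral_const_mul, integral_const_mul, integral_finsetSum _ fun a _ => hi a n]
    simp only [(h _ n).2, ← Finset.mul_sum]
    rw [← hn]; ring
  simp_rw [he]
  have := (tendsto_inv_atTop_zero.comp (Real.tendsto_sqrt_atTop.comp
    tendsto_natCast_atTop_atTop)).mul_const (C * ∑ a, Var[fun ω => g a (x 0 ω); P])
  simpa using this

/-- Consistency of the sample covariance matrix, from the strong law of large numbers. -/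
theorem tendstoInMeasure_sampleCov {x : ℕ → Ω → EuclideanSpace ℝ (Fin p)}
    (hindep : iIndepFun x P) (hident : ∀ i, IdentDistrib (x i) (x 0) P P)
    (hL2 : ∀ j, MemLp (fun ω => x 0 ω j) 2 P) {A : Matrix (Fin p) (Fin p) ℝ}
    (hA : ∀ j k, ∫ ω, x 0 ω j * x 0 ω k ∂P = A j k) :
    TendstoInMeasure P (fun n ω => ∑ j, ∑ k, (sampleCov x n ω j k - A j k) ^ 2) atTop 0 := by
  have hm : ∀ i j, AEMeasurable (fun ω => x i ω j) P := fun i j =>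
    (EuclideanSpace.proj (𝕜 := ℝ) j).measurable.comp_aemeasurable (hident i).aemeasurable_fst
  have hS : ∀ n j k ω, sampleCov x n ω j k = (∑ i ∈ Finset.range n, x i ω j * x i ω k) / n :=
    fun n j k ω => by
      simp [sampleCov, Matrix.sum_apply, vecMulVec_apply, div_eq_inv_mul]
  simp only [hS]
  refine tendstoInMeasure_of_tendsto_ae (fun n => ?_) ?_
  · refine AEMeasurable.aestronglyMeasurable ?_
    exact Finset.aemeasurable_fun_sum _ fun j _ => Finset.aemeasurable_fun_sum _ fun k _ =>
      (((Finset.aemeasurable_fun_sum _ fun i _ => (hm i j).mul (hm i k)).div_const _).sub_const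
        _).pow_const _
  · have hg : ∀ j k, Measurable fun y : EuclideanSpace ℝ (Fin p) => y j * y k := fun j k => by
      fun_prop
    have hlln := fun j k => strong_law_ae_real (fun i ω => x i ω j * x i ω k)
      ((hL2 j).integrable_mul (hL2 k))
      (fun a b hab => (hindep.indepFun hab).comp (hg j k) (hg j k))
      (fun i => (hident i).comp (hg j k))
    simp only [hA] at hlln
    filter_upwards [ae_all_iff.2 fun j => ae_all_iff.2 (hlln j)] with ω hω
    have : Tendsto (fun n : ℕ => ∑ j, ∑ k,
        ((∑ i ∈ Finset.range n, x i ω j * x i ω k) / n - A j k) ^ 2) atTop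
        (𝓝 (∑ j, ∑ k, (A j k - A j k) ^ 2)) :=
      tendsto_finsetSum _ fun j _ => tendsto_finsetSum _ fun k _ =>
        ((hω j k).sub_const _).pow 2
    simpa using this

open scoped Matrix.Norms.Frobenius in
theorem norm_toLp_vec (A : Matrix (Fin p) (Fin p) ℝ) :
    ‖(WithLp.toLp 2 A.vec : EuclideanSpace ℝ (Fin p × Fin p))‖ = ‖A‖ := by
  rw [← sq_eq_sq₀ (norm_nonneg _) (norm_nonneg _), frobenius_norm_sq,
    EuclideanSpace.real_norm_sq_eq, Fintype.sum_prod_type, Finset.sum_comm]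
  rfl

theorem IsNoiseProjector.transpose_eq {A Q : Matrix (Fin p) (Fin p) ℝ}
    (h : IsNoiseProjector q A Q) : Qᵀ = Q := by
  obtain ⟨G, l, -, rfl⟩ := h.exists_eq
  exact conj_diagonal_transpose _ _

theorem IsNoiseProjector.mul_self {A Q : Matrix (Fin p) (Fin p) ℝ}
    (h : IsNoiseProjector q A Q) : Q * Q = Q := by
  obtain ⟨G, l, hG, rfl⟩ := h.exists_eq
  exact conj_indicator_mul_self hG.orthogonal _

end Assembly

end SpikedCov

theorem proposition3
    {Ω Ω' : Type*} [MeasurableSpace Ω] [MeasurableSpace Ω']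
    (P : Measure Ω) [IsProbabilityMeasure P] (P' : Measure Ω') [IsProbabilityMeasure P']
    (p q : ℕ) (σ : ℝ) (hσ : 0 < σ)
    -- the mixing matrix, with `q` linearly independent columns
    (M : Matrix (Fin p) (Fin q) ℝ) (hM : LinearIndependent ℝ M.col)
    -- a generic signal `s` and a generic white noise `w`, independent of each other
    (s : Ω' → EuclideanSpace ℝ (Fin q)) (w : Ω' → EuclideanSpace ℝ (Fin p))
    (hs : MemLp s 2 P') (hs_mean : ∫ ω, s ω ∂P' = 0)
    (hs_cov : (SpikedCov.covMatrix s P').PosDef)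
    (hw : HasLaw w (multivariateGaussian 0 1) P')
    (hsw : IndepFun s w P')
    -- the observations: independent, each distributed as `M s + √σ w`
    (x : ℕ → Ω → EuclideanSpace ℝ (Fin p))
    (hx_indep : iIndepFun x P)
    (hx : ∀ i, IdentDistrib (x i) (fun ω => WithLp.toLp 2 (M *ᵥ (s ω)) + √σ • w ω) P P')
    -- the noise projectors of the true and of the sample covariance matrices
    (QU : Matrix (Fin p) (Fin p) ℝ)
    (hQU : SpikedCov.IsNoiseProjector q (SpikedCov.covMatrix (x 0) P) QU)
    (QG : ℕ → Ω → Matrix (Fin p) (Fin p) ℝ)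
    (hQG_meas : ∀ n j k, AEMeasurable (fun ω => QG n ω j k) P)
    (hQG : ∀ n, ∀ᵐ ω ∂P, SpikedCov.IsNoiseProjector q (SpikedCov.sampleCov x n ω) (QG n ω)) :
    (SpikedCov.noiseAsymptoticCov QU (SpikedCov.covMatrix (x 0) P)).PosSemidef ∧
    TendstoInDistribution
      (fun (n : ℕ) ω => WithLp.toLp 2
        (√(n : ℝ) • (QG n ω * (SpikedCov.sampleCov x n ω - σ • 1) * QG n ω).vec))
      atTop
      (fun z : EuclideanSpace ℝ (Fin p × Fin p) => z)
      (fun _ => P)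
      (multivariateGaussian 0
        (SpikedCov.noiseAsymptoticCov QU (SpikedCov.covMatrix (x 0) P))) := by
  rw [multivariateGaussian_zero_one] at hw
  have hident : ∀ i, IdentDistrib (x i) (x 0) P P := fun i => (hx i).trans (hx 0).symm
  -- every statistic of `x 0` can be computed on the model space
  have htransfer : ∀ {f : EuclideanSpace ℝ (Fin p) → ℝ}, Measurable f →
      IdentDistrib (fun ω => f (x 0 ω)) (fun ω => f (SpikedCov.observation M σ s w ω)) P P' :=
    fun hf => (hx 0).comp hf
  have hcoord : ∀ j, Measurable fun y : EuclideanSpace ℝ (Fin p) => y j := fun j => by fun_prop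
  have hmulVec : ∀ j, Measurable fun y : EuclideanSpace ℝ (Fin p) => (QU *ᵥ y) j := fun j => by
    simp only [mulVec, dotProduct]; fun_prop
  have hcov : ∀ {f g : EuclideanSpace ℝ (Fin p) → ℝ}, Measurable f → Measurable g →
      cov[fun ω => f (x 0 ω), fun ω => g (x 0 ω); P] =
        cov[fun ω => f (SpikedCov.observation M σ s w ω),
          fun ω => g (SpikedCov.observation M σ s w ω); P'] := fun {f g} hf hg => by
    have h1 := covariance_map_fun (μ := P) (Z := x 0) hf.aestronglyMeasurable
      hg.aestronglyMeasurable (hx 0).aemeasurable_fst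
    rw [(hx 0).map_eq] at h1
    rw [← h1]
    exact covariance_map_fun hf.aestronglyMeasurable hg.aestronglyMeasurable
      (hx 0).aemeasurable_snd
  have hA : SpikedCov.covMatrix (x 0) P = M * SpikedCov.covMatrix s P' * Mᵀ + σ • 1 := by
    ext j k
    rw [← SpikedCov.covariance_observation hσ.le hs hw hsw]
    exact hcov (hcoord j) (hcoord k)
  have hQt := hQU.transpose_eq
  have hQ := hQU.mul_self
  obtain ⟨U, a, hU, hQUeq⟩ := hQU.exists_eq
  have hL2 : ∀ j, MemLp (fun ω => x 0 ω j) 2 P := fun j =>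
    (htransfer (hcoord j)).symm.memLp_snd (SpikedCov.memLp_observation_apply hs hw j)
  have hmean : ∀ j, ∫ ω, x 0 ω j ∂P = 0 := fun j => by
    rw [(htransfer (hcoord j)).integral_eq, SpikedCov.integral_observation_apply hs hs_mean hw]
  have hsecond : ∀ j k, ∫ ω, x 0 ω j * x 0 ω k ∂P = SpikedCov.covMatrix (x 0) P j k :=
    fun j k => by
      rw [SpikedCov.covMatrix, of_apply, covariance_eq_sub (hL2 j) (hL2 k), hmean, zero_mul,
        sub_zero]
      rfl
  have hgap := SpikedCov.spiked_eigenvalues hM hs_cov (hA ▸ hU)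
  have hQM : QU * M = 0 := by
    rw [hQUeq]; exact SpikedCov.noiseProjector_mul_eq_zero hM hs_cov (hA ▸ hU)
  have hAQ : SpikedCov.covMatrix (x 0) P * QU = σ • QU := by
    have hMQ : Mᵀ * QU = 0 := by
      rw [← transpose_transpose QU, ← transpose_mul, hQt, hQM, transpose_zero]
    rw [hA, Matrix.add_mul, Matrix.mul_assoc, hMQ]
    simp
  -- the entries of the limiting covariance matrix
  have hΩ := SpikedCov.noiseAsymptoticCov_apply hQ hAQ
  -- the summands of the central limit theorem
  have hψ := SpikedCov.measurable_noiseSummand (σ := σ) hQt hQ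
  have hprod : ∀ b c, Measurable fun y : EuclideanSpace ℝ (Fin p) =>
      (QU *ᵥ y) b * (QU *ᵥ y) c := fun b c => (hmulVec b).mul (hmulVec c)
  have hφ : ∀ b c, Measurable fun y : EuclideanSpace ℝ (Fin p) =>
      (QU *ᵥ y) b * y c - σ * QU b c := fun b c => ((hmulVec b).mul (hcoord c)).sub_const _
  have hφL2 : ∀ b c, MemLp (fun ω => (QU *ᵥ x 0 ω) b * x 0 ω c - σ * QU b c) 2 P := fun b c =>
    (htransfer (hφ b c)).symm.memLp_snd
      ((SpikedCov.memLp_mulVec_observation_mul hs hw hsw hQM b c).sub (memLp_const _))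
  have hφ0 : ∀ b c, ∫ ω, ((QU *ᵥ x 0 ω) b * x 0 ω c - σ * QU b c) ∂P = 0 := fun b c => by
    rw [(htransfer (hφ b c)).integral_eq, integral_sub
      ((SpikedCov.memLp_mulVec_observation_mul hs hw hsw hQM b c).integrable (by simp))
      (integrable_const _), SpikedCov.integral_mulVec_observation_mul hσ.le hs hs_mean hw hsw hQM]
    simp
  -- a row of `Q (x xᵀ - σ)` times `Q`, which gives integrability and mean zero at once
  have hψφ : ∀ (y : EuclideanSpace ℝ (Fin p)) b, SpikedCov.noiseSummand σ QU y b =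
      ∑ i, ((QU *ᵥ y) b.2 * y i - σ * QU b.2 i) * QU i b.1 := fun y b => by
    simp only [← SpikedCov.mul_vecMulVec_self_apply]
    exact mul_apply
  have hψL2 : MemLp (fun ω => SpikedCov.noiseSummand σ QU (x 0 ω)) 2 P := by
    refine MemLp.of_eval_piLp fun b => ?_
    simp only [hψφ]
    exact memLp_finsetSum _ fun i _ => (hφL2 _ _).mul_const _
  have hψ0 : ∀ b, ∫ ω, SpikedCov.noiseSummand σ QU (x 0 ω) b ∂P = 0 := fun b => by
    simp only [hψφ]
    rw [integral_finsetSum _ fun i _ => ((hφL2 _ _).integrable (by simp)).mul_const _]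
    exact Finset.sum_eq_zero fun i _ => by rw [integral_mul_const, hφ0, zero_mul]
  have hQQint : ∀ b c, Integrable (fun ω => (QU *ᵥ x 0 ω) b * (QU *ᵥ x 0 ω) c) P :=
    fun b c => by
      have h := ((EuclideanSpace.proj (𝕜 := ℝ) (c, b)).comp_memLp' hψL2).integrable (by simp)
      refine (h.add (integrable_const (σ * QU b c))).congr (.of_forall fun ω => ?_)
      simp [SpikedCov.noiseSummand_apply hQt hQ]
  have hψcov : ∀ b c, cov[fun ω => SpikedCov.noiseSummand σ QU (x 0 ω) b,
      fun ω => SpikedCov.noiseSummand σ QU (x 0 ω) c; P] =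
      SpikedCov.noiseAsymptoticCov QU (SpikedCov.covMatrix (x 0) P) b c := fun b c => by
    simp only [SpikedCov.noiseSummand_apply hQt hQ]
    rw [covariance_sub_const_left (hQQint _ _), covariance_sub_const_right (hQQint _ _),
      hcov (hprod _ _) (hprod _ _),
      SpikedCov.covariance_mulVec_observation_mul hσ.le hw hQt hQ hQM, hΩ]
    ring
  refine ⟨SpikedCov.posSemidef_of_covariance hψL2 hψcov, ?_⟩
  have hclt := SpikedCov.tendstoInDistribution_multivariateGaussian
    (X := fun i ω => SpikedCov.noiseSummand σ QU (x i ω)) hψL2 hψ0 hψcov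
    (hx_indep.comp (fun _ => SpikedCov.noiseSummand σ QU) fun _ => hψ)
    (fun i => (hident i).comp hψ)
  refine tendstoInDistribution_of_tendstoInMeasure_sub _ _ hclt ?_ fun n => ?_
  -- exchanging the two projectors costs `O(√n ‖Q T‖²)` as soon as `‖S - Σ‖ ≤ ε`
  · obtain ⟨ε, hε, C, hC, hpert⟩ := SpikedCov.exists_norm_compression_sub_le hU hQUeq hgap.1 hgap.2
    refine SpikedCov.tendstoInMeasure_zero_of_dominated (pow_pos hε 2)
      (SpikedCov.tendstoInMeasure_sampleCov hx_indep hident hL2 hsecond)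
      (SpikedCov.tendstoInMeasure_sqrt_mul_sum_sq_mean (κ := Fin p × Fin p) hx_indep hident
        (fun b => hφ b.1 b.2) (fun b => hφL2 b.1 b.2) (fun b => hφ0 b.1 b.2) hC) fun n => ?_
    filter_upwards [hQG n] with ω hω hB
    rcases eq_or_ne n 0 with rfl | hn
    · simp
    have hS := hpert _ _ hω (by
      refine (abs_le_of_sq_le_sq' ?_ hε.le).2
      rw [SpikedCov.frobenius_norm_sq]
      exact ((le_abs_self _).trans hB.le))
    rw [SpikedCov.frobenius_norm_sq] at hS
    simp only [SpikedCov.mul_sampleCov_sub_apply x QU hn] at hS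
    rw [Pi.sub_apply, Pi.sub_apply, ← SpikedCov.sqrt_smul_vec_compression, ← WithLp.toLp_sub,
      ← smul_sub, ← vec_sub, WithLp.toLp_smul, norm_smul, SpikedCov.norm_toLp_vec,
      Real.norm_of_nonneg (Real.sqrt_nonneg _), Fintype.sum_prod_type, mul_left_comm]
    exact mul_le_mul_of_nonneg_left hS (Real.sqrt_nonneg _)
  · have hSm : ∀ j k, AEMeasurable
        (fun ω => (SpikedCov.sampleCov x n ω - σ • 1 : Matrix (Fin p) (Fin p) ℝ) j k) P :=
      fun j k => (SpikedCov.aemeasurable_sampleCov_apply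
        (fun i => (hident i).aemeasurable_fst) n j k).sub_const _
    have hm := SpikedCov.aemeasurable_matrix_mul
      (SpikedCov.aemeasurable_matrix_mul (hQG_meas n) hSm) (hQG_meas n)
    refine (WithLp.measurable_toLp 2 _).comp_aemeasurable (aemeasurable_pi_iff.2 fun b => ?_)
    exact (hm b.2 b.1).const_mul _
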